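/- A nondeterministic Büchi automaton $\mathcal{A}=\langle\Sigma,Q,\delta,Q_0,\alpha\rangle$ consists of a finite alphabet $\Sigma$, a finite set of states $Q$, a transition function $\delta:Q\times\Sigma\to 2^Q$, a set $Q_0\subseteq Q$ of initial states and a set $\alpha\subseteq Q$ of accepting states; its language $\mathfrak{L}(\mathcal{A})\subseteq\Sigma^\omega$ is the set of infinite words on which $\mathcal{A}$ has a run that visits some state of $\alpha$ infinitely often. Two words $w,w'\in\Sigma^\omega$ are permutations of each other, written $w\sim w'$, if every letter of $\Sigma$ has the same number of occurrences (an element of $\mathbb{N}\cup\{\infty\}$) in $w$ and in $w'$. The jumping language of $\mathcal{A}$ is \[\mathfrak{J}(\mathcal{A})=\{w\in\Sigma^\omega \mid \exists\, w'\sim w \text{ such that } w'\in\mathfrak{L}(\mathcal{A})\}.\] Proposition. Given Büchi automata $\mathcal{A}$ and $\mathcal{B}$ over a common finite alphabet $\Sigma$, one can effectively construct an automaton $\mathcal{C}$ over $\Sigma$ such that $\mathfrak{J}(\mathcal{C})=\mathfrak{J}(\mathcal{A})\cap\mathfrak{J}(\mathcal{B})$. That is, there is a computable function which maps $|\Sigma|$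 and finite descriptions of any two such automata $\mathcal{A},\mathcal{B}$ to a description of such a $\mathcal{C}$. -/

import Mathlib

namespace JumpingAutomata

universe u v

/-! Automata are Mathlib's `NFA α Q` (transition function `Q → α → Set Q`, a set of initial states
and a set of accepting states), read here over infinite words `ℕ → α` with Büchi acceptance. The
alphabet `α` and the state type `Q` are finite in all uses. -/

/-- `ρ` is a run of `A` on the infinite word `w`; the letter `w i` is read between the states `ρ i`
and `ρ (i + 1)`. -/
def IsRun {α : Type u} {Q : Type v} (A : NFA α Q) (w : ℕ → α) (ρ : ℕ → Q) : Prop :=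
  ρ 0 ∈ A.start ∧ ∀ i, ρ (i + 1) ∈ A.step (ρ i) (w i)

/-- The states that a sequence visits infinitely often. -/
def infStates {Q : Type v} (ρ : ℕ → Q) : Set Q :=
  {q | ∀ i, ∃ j, i < j ∧ ρ j = q}

/-- The language of infinite words accepted by `A` under the Büchi condition. -/
def buchiLanguage {α : Type u} {Q : Type v} (A : NFA α Q) : Set (ℕ → α) :=
  {w | ∃ ρ : ℕ → Q, IsRun A w ρ ∧ (infStates ρ ∩ A.accept).Nonempty}

/-- The Parikh image of an infinite word: each letter is sent to its number of occurrences,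
which is `⊤` if the letter occurs infinitely often. -/
noncomputable def parikh {α : Type u} (w : ℕ → α) : α → ℕ∞ :=
  fun a => {i : ℕ | w i = a}.encard

/-- The jumping language of `A`: the infinite words with a permutation (that is, a word with the
same Parikh image) accepted by `A`. -/
def jumpingLanguage {α : Type u} {Q : Type v} (A : NFA α Q) : Set (ℕ → α) :=
  {w | ∃ w' : ℕ → α, parikh w' = parikh w ∧ w' ∈ buchiLanguage A}

/-- Finite descriptions of automata, the inputs and outputs of algorithms: the number of states,
the list of transitions (source, letter, target), the list of initial states and the list of
accepting states, where states and letters are given by their numbers. Entries that are out of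
range carry no meaning. -/
abbrev AutomatonCode : Type := ℕ × List (ℕ × ℕ × ℕ) × List ℕ × List ℕ

namespace AutomatonCode

/-- The number of states. -/
abbrev numStates (c : AutomatonCode) : ℕ := c.1

/-- The list of transitions. -/
abbrev transitions (c : AutomatonCode) : List (ℕ × ℕ × ℕ) := c.2.1

/-- The list of initial states. -/
abbrev initial (c : AutomatonCode) : List ℕ := c.2.2.1

/-- The list of accepting states. -/
abbrev accepting (c : AutomatonCode) : List ℕ := c.2.2.2

/-- The automaton described by `c`, over an alphabet whose letters are numbered by `e`. -/
def toNFA {α : Type u} {k : ℕ} (c : AutomatonCode) (e : α ≃ Fin k) : NFA α (Fin c.numStates) where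
  step q a := {q' | ((q : ℕ), (e a : ℕ), (q' : ℕ)) ∈ c.transitions}
  start := {q | (q : ℕ) ∈ c.initial}
  accept := {q | (q : ℕ) ∈ c.accepting}

/-- `c` describes the automaton `A`, over an alphabet whose letters are numbered by `e`: under some
numbering of the states of `A`, the data of `A` are those listed in `c`. -/
def Describes {α : Type u} {Q : Type v} {k : ℕ} (c : AutomatonCode) (e : α ≃ Fin k)
    (A : NFA α Q) : Prop :=
  ∃ g : Q ≃ Fin c.numStates,
    (∀ q a q', q' ∈ A.step q a ↔ ((g q : ℕ), (e a : ℕ), (g q' : ℕ)) ∈ c.transitions) ∧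
    (∀ q, q ∈ A.start ↔ (g q : ℕ) ∈ c.initial) ∧
    (∀ q, q ∈ A.accept ↔ (g q : ℕ) ∈ c.accepting)

theorem describes_toNFA {α : Type u} {k : ℕ} (c : AutomatonCode) (e : α ≃ Fin k) :
    c.Describes e (c.toNFA e) :=
  ⟨Equiv.refl _, fun _ _ _ => Iff.rfl, fun _ => Iff.rfl, fun _ => Iff.rfl⟩

/-- Every finite automaton has a description. -/
theorem exists_describes {α : Type u} {Q : Type v} [Finite Q] {k : ℕ} (e : α ≃ Fin k)
    (A : NFA α Q) : ∃ c : AutomatonCode, c.Describes e A := by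
  classical
  obtain ⟨n, ⟨g⟩⟩ := Finite.exists_equiv_fin Q
  have : Finite α := Finite.of_equiv _ e.symm
  have hT : {t : ℕ × ℕ × ℕ | ∃ q a q', q' ∈ A.step q a ∧
      t = ((g q : ℕ), (e a : ℕ), (g q' : ℕ))}.Finite := by
    refine (Set.finite_range
      (fun x : Q × α × Q => ((g x.1 : ℕ), (e x.2.1 : ℕ), (g x.2.2 : ℕ)))).subset ?_
    rintro _ ⟨q, a, q', _, rfl⟩
    exact ⟨(q, a, q'), rfl⟩
  have hI : ((fun q => (g q : ℕ)) '' A.start).Finite := Set.toFinite _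
  have hF : ((fun q => (g q : ℕ)) '' A.accept).Finite := Set.toFinite _
  refine ⟨(n, hT.toFinset.toList, hI.toFinset.toList, hF.toFinset.toList), g, ?_, ?_, ?_⟩
  · intro q a q'
    simp only [transitions, Finset.mem_toList, Set.Finite.mem_toFinset, Set.mem_ofPred_eq,
      Prod.mk.injEq, Fin.val_inj, EmbeddingLike.apply_eq_iff_eq]
    exact ⟨fun h => ⟨q, a, q', h, rfl, rfl, rfl⟩,
      fun ⟨_, _, _, h, h₁, h₂, h₃⟩ => by rw [h₁, h₂, h₃]; exact h⟩
  · intro q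
    simp [initial, Fin.val_inj]
  · intro q
    simp [accepting, Fin.val_inj]

end AutomatonCode

end JumpingAutomata

/-! A permutation does not change the *profile* of an infinite word: the set `S` of letters that
occur infinitely often, and the finite multiset of the occurrences of the other letters. So a word
belongs to the jumping language of `A` if and only if its profile is that of some accepted word,
that is, of some run to an accepting state `q` followed by a loop at `q` with letter set `S`.

The accepted profiles are described by finitely many pairs of a set `S` and a linear set of
multisets. Indeed, a long walk can be shortened by repeatedly cutting out a cycle, unless this
removes a transition altogether; the shortened walk still visits the vertices of all the cycles cut
out, so these can be put back any number of times, and their words are periods.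

Linear sets have effective intersections. If a list of integer vectors with bounded entries sums to
zero, then it can be split up into short blocks that sum to zero: for a single coordinate, order the
list such that the partial sums stay bounded, and apply the pigeonhole principle; then treat the
coordinates one by one. Hence the solutions of the equation between two linear sets are generated by
the short ones.

Conversely, a finite union of pairs of a set and a linear set is realised by an automaton that
first reads words of the linear set and then repeats the letters of `S`. -/

namespace JumpingAutomata

open List

/-! ### Zero-sum blocks -/

section ZeroSum

variable {β : Type*}

theorem exists_abs_add_le_of_sum_eq_zero {f : β → ℤ} {K s : ℤ} {l : List β} (hl : l ≠ [])
    (hf : ∀ b ∈ l, |f b| ≤ K) (hs : |s| ≤ K) (hsum : s + (l.map f).sum = 0) :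
    ∃ b ∈ l, |s + f b| ≤ K := by
  by_contra! hlt
  rcases lt_or_ge 0 s with hpos | hneg
  · have hnonneg : 0 ≤ (l.map f).sum := sum_nonneg fun x hx => by
      obtain ⟨b, hb, rfl⟩ := mem_map.1 hx
      by_contra! hfb
      exact (hlt b hb).not_ge (abs_le.2 ⟨by linarith [neg_le_of_abs_le (hf b hb)],
        by linarith [le_of_abs_le hs]⟩)
    linarith
  · have hnegative : (l.map f).sum < (l.map fun _ => (0 : ℤ)).sum := by
      refine sum_lt_sum_of_ne_nil hl _ _ fun b hb => ?_
      by_contra! hfb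
      exact (hlt b hb).not_ge (abs_le.2 ⟨by linarith [neg_le_of_abs_le hs],
        by linarith [le_of_abs_le (hf b hb)]⟩)
    simp only [map_const', sum_replicate, smul_zero] at hnegative
    linarith

theorem exists_perm_abs_sum_take_le {f : β → ℤ} {K : ℤ} :
    ∀ {l : List β} {s : ℤ}, (∀ b ∈ l, |f b| ≤ K) → |s| ≤ K → s + (l.map f).sum = 0 →
      ∃ l', l' ~ l ∧ ∀ n, |s + ((l'.take n).map f).sum| ≤ K := by
  intro l
  induction hn : l.length generalizing l with
  | zero =>
    intro s _ hs _
    exact ⟨l, .rfl, fun n => by simpa [length_eq_zero_iff.1 hn] using hs⟩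
  | succ n ih =>
    intro s hf hs hsum
    obtain ⟨b, hb, hsb⟩ :=
      exists_abs_add_le_of_sum_eq_zero (ne_nil_of_length_eq_add_one hn) hf hs hsum
    obtain ⟨l₁, l₂, rfl⟩ := append_of_mem hb
    have hperm : b :: (l₁ ++ l₂) ~ l₁ ++ b :: l₂ := perm_middle.symm
    have hsum' : s + f b + ((l₁ ++ l₂).map f).sum = 0 := by
      rw [← hsum, ← (hperm.map f).sum_eq, map_cons, sum_cons, add_assoc]
    obtain ⟨l', hl', htake⟩ := ih (l := l₁ ++ l₂) (by simpa [← hperm.length_eq] using hn)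
      (fun c hc => hf c (hperm.mem_iff.1 (mem_cons_of_mem b hc))) hsb hsum'
    refine ⟨b :: l', (hl'.cons b).trans hperm, fun n => ?_⟩
    cases n with
    | zero => simpa using hs
    | succ n => simpa [add_assoc] using htake n

theorem exists_perm_append_sum_eq_zero {f : β → ℤ} {K : ℕ} {l : List β}
    (hf : ∀ b ∈ l, |f b| ≤ K) (hsum : (l.map f).sum = 0) (hlen : 2 * K + 1 < l.length) :
    ∃ x y, x ++ y ~ l ∧ x ≠ [] ∧ x.length ≤ 2 * K + 1 ∧ (x.map f).sum = 0 := by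
  obtain ⟨l', hl', htake⟩ :=
    exists_perm_abs_sum_take_le (s := 0) hf (by simp) (by simpa using hsum)
  let prefixSum (n : ℕ) : ℤ := ((l'.take n).map f).sum
  have hcard : (Finset.Icc (-K : ℤ) K).card < (Finset.range (2 * K + 2)).card := by
    simp only [Int.card_Icc, Finset.card_range]
    omega
  obtain ⟨i, hi, j, hj, hne, heq⟩ := Finset.exists_ne_map_eq_of_card_lt_of_maps_to hcard
    (f := prefixSum) fun n _ => by
      simpa [prefixSum, abs_le] using htake n
  wlog hij : i < j generalizing i j
  · exact this j hj i hi hne.symm heq.symm (by omega)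
  rw [Finset.mem_range] at hj
  have hlen' := hl'.length_eq
  refine ⟨(l'.take j).drop i, l'.take i ++ l'.drop j, ?_, ?_, ?_, ?_⟩
  · calc (l'.take j).drop i ++ (l'.take i ++ l'.drop j)
        ~ (l'.take j).take i ++ (l'.take j).drop i ++ l'.drop j := by
          rw [take_take, min_eq_left hij.le, ← append_assoc]
          exact perm_append_comm.append_right _
      _ = l' := by rw [take_append_drop, take_append_drop]
      _ ~ l := hl'
  · refine ne_nil_of_length_pos ?_
    simp only [length_drop, length_take]
    omega
  · simp only [length_drop, length_take]
    omega
  · have hsplit : prefixSum j = prefixSum i + (((l'.take j).drop i).map f).sum := by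
      conv_lhs => rw [show prefixSum j = ((l'.take j).map f).sum from rfl,
        ← take_append_drop i (l'.take j), map_append, sum_append, take_take, min_eq_left hij.le]
    linarith

theorem exists_flatten_perm_sum_eq_zero {f : β → ℤ} {K : ℕ} {l : List β}
    (hf : ∀ b ∈ l, |f b| ≤ K) (hsum : (l.map f).sum = 0) :
    ∃ ls : List (List β), ls.flatten ~ l ∧
      ∀ x ∈ ls, x.length ≤ 2 * K + 1 ∧ (x.map f).sum = 0 := by
  induction hn : l.length using Nat.strong_induction_on generalizing l with
  | _ n ih =>
    by_cases hlen : l.length ≤ 2 * K + 1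
    · exact ⟨[l], by simp, by simpa using ⟨hlen, hsum⟩⟩
    · obtain ⟨x, y, hxy, hne, hx, hsumx⟩ := exists_perm_append_sum_eq_zero hf hsum (by omega)
      have hsumy : (y.map f).sum = 0 := by
        simpa [hsumx, hsum] using (hxy.map f).sum_eq
      obtain ⟨ls, hls, hblocks⟩ := ih y.length
        (by have := hxy.length_eq; have := length_pos_iff.2 hne; grind)
        (fun b hb => hf b (hxy.mem_iff.1 (mem_append_right x hb))) hsumy rfl
      exact ⟨x :: ls, (hls.append_left x).trans hxy, forall_mem_cons.2 ⟨⟨hx, hsumx⟩, hblocks⟩⟩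

/-- The bound on the lengths of the blocks into which a list can be split up when `d` functionals
with values in `[-K, K]` sum to zero over the list and are required to do so over each block. -/
def zeroSumBound (K : ℕ) : ℕ → ℕ
  | 0 => 1
  | d + 1 => zeroSumBound K d * (2 * (zeroSumBound K d * K) + 1)

theorem length_flatten_le_mul {N M : ℕ} {ls : List (List β)} (hls : ls.length ≤ M)
    (h : ∀ l ∈ ls, l.length ≤ N) : ls.flatten.length ≤ N * M := by
  rw [length_flatten]
  calc (ls.map length).sum ≤ (ls.map length).length • N :=
        sum_le_card_nsmul _ _ (by simpa using h)
    _ ≤ N * M := by rw [length_map, smul_eq_mul, mul_comm]; gcongr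

theorem abs_sum_map_le {f : β → ℤ} {K N : ℕ} {l : List β} (hf : ∀ b ∈ l, |f b| ≤ K)
    (hl : l.length ≤ N) : |(l.map f).sum| ≤ (N * K : ℕ) := by
  have h : ∀ l : List β, (∀ b ∈ l, |f b| ≤ K) → |(l.map f).sum| ≤ l.length * K := by
    intro l
    induction l with
    | nil => simp
    | cons b l ih =>
      intro hf
      rw [forall_mem_cons] at hf
      have := abs_add_le (f b) (l.map f).sum
      simp only [map_cons, sum_cons, length_cons, Nat.cast_add, Nat.cast_one]
      linarith [ih hf.2, hf.1]
  refine (h l hf).trans ?_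
  exact_mod_cast Nat.mul_le_mul_right K hl

theorem exists_flatten_perm_forall_sum_eq_zero {K : ℕ} {fs : List (β → ℤ)} {l : List β}
    (hfs : ∀ f ∈ fs, ∀ b ∈ l, |f b| ≤ K) (hsum : ∀ f ∈ fs, (l.map f).sum = 0) :
    ∃ ls : List (List β), ls.flatten ~ l ∧
      ∀ x ∈ ls, x.length ≤ zeroSumBound K fs.length ∧ ∀ f ∈ fs, (x.map f).sum = 0 := by
  induction fs with
  | nil =>
    refine ⟨l.map fun b => [b], by rw [← flatMap_def, flatMap_singleton'], ?_⟩
    simp [zeroSumBound]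
  | cons f fs ih =>
    rw [forall_mem_cons] at hfs hsum
    obtain ⟨ls, hls, hblocks⟩ := ih hfs.2 hsum.2
    have hmem : ∀ x ∈ ls, ∀ b ∈ x, b ∈ l := fun x hx b hb =>
      hls.mem_iff.1 (mem_flatten_of_mem hx hb)
    -- Group the blocks so that `f` sums to zero over each group as well.
    obtain ⟨lss, hlss, hgroups⟩ := exists_flatten_perm_sum_eq_zero
      (f := fun x : List β => (x.map f).sum) (K := zeroSumBound K fs.length * K) (l := ls)
      (fun x hx => abs_sum_map_le (fun b hb => hfs.1 b (hmem x hx b hb)) (hblocks x hx).1)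
      (by rw [← hsum.1, ← (hls.map f).sum_eq, map_flatten, sum_flatten, map_map]; rfl)
    have hsub : ∀ xs ∈ lss, ∀ x ∈ xs, x ∈ ls := fun xs hxs x hx =>
      hlss.mem_iff.1 (mem_flatten_of_mem hxs hx)
    have hsum_flatten : ∀ (g : β → ℤ) (xs : List (List β)),
        (xs.flatten.map g).sum = (xs.map fun x => (x.map g).sum).sum := fun g xs => by
      rw [map_flatten, sum_flatten, map_map]; rfl
    refine ⟨lss.map flatten, ?_, ?_⟩
    · rw [← flatten_flatten]
      exact hlss.flatten.trans hls
    · simp only [forall_mem_map, forall_mem_cons]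
      refine fun xs hxs => ⟨length_flatten_le_mul (hgroups xs hxs).1
        fun x hx => (hblocks x (hsub xs hxs x hx)).1, ?_, fun g hg => ?_⟩
      · rw [hsum_flatten]
        exact (hgroups xs hxs).2
      · rw [hsum_flatten]
        refine sum_eq_zero fun y hy => ?_
        obtain ⟨x, hx, rfl⟩ := mem_map.1 hy
        exact (hblocks x (hsub xs hxs x hx)).2 g hg

end ZeroSum

/-! ### Linear sets and profiles -/

theorem exists_subset_map_eq {β γ : Type*} {f : β → γ} {l : List β} {ys : List γ}
    (h : ys ⊆ l.map f) : ∃ xs ⊆ l, xs.map f = ys := by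
  induction ys with
  | nil => exact ⟨[], nil_subset l, rfl⟩
  | cons y ys ih =>
    rw [cons_subset] at h
    obtain ⟨x, hx, rfl⟩ := mem_map.1 h.1
    obtain ⟨xs, hxs, rfl⟩ := ih h.2
    exact ⟨x :: xs, cons_subset.2 ⟨hx, hxs⟩, rfl⟩

/-- The lists of length at most `n` with entries in `E`. -/
def boundedLists {β : Type*} (E : List β) : ℕ → List (List β)
  | 0 => [[]]
  | n + 1 => [] :: E.flatMap fun b => (boundedLists E n).map (cons b)

theorem mem_boundedLists {β : Type*} {E : List β} {n : ℕ} {l : List β} :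
    l ∈ boundedLists E n ↔ l.length ≤ n ∧ l ⊆ E := by
  induction n generalizing l with
  | zero => simp +contextual [boundedLists]
  | succ n ih =>
    cases l with
    | nil => simp [boundedLists]
    | cons b l => simp [boundedLists, ih, and_left_comm]

/-- A description of a linear set of multisets: a word whose letters form the base and words whose
letters form the periods. -/
abbrev LinearCode (α : Type*) : Type _ := List α × List (List α)

namespace LinearCode

variable {α : Type*}

/-- The linear set described by a code: the base plus finitely many periods, which may be
repeated. -/
def toSet (X : LinearCode α) : Set (Multiset α) :=
  {m | ∃ zs ⊆ X.2, m = ↑(X.1 ++ zs.flatten)}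

theorem mem_toSet_of_subset_cons_nil {X : LinearCode α} {zs : List (List α)} (h : zs ⊆ [] :: X.2) :
    (↑(X.1 ++ zs.flatten) : Multiset α) ∈ X.toSet := by
  classical
  refine ⟨zs.filter (· ≠ []), fun z hz => ?_, by rw [flatten_filter_ne_nil]⟩
  obtain ⟨hz, hne⟩ := mem_filter.1 hz
  exact (mem_cons.1 (h hz)).resolve_left (of_decide_eq_true hne)

/-- A list of pairs of words is balanced if its first components have the same letters
altogether as its second components. Intersecting two linear sets amounts to solving this
equation. -/
def Balanced (qs : List (List α × List α)) : Prop :=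
  qs.flatMap Prod.fst ~ qs.flatMap Prod.snd

instance [DecidableEq α] (qs : List (List α × List α)) : Decidable (Balanced qs) :=
  inferInstanceAs (Decidable (_ ~ _))

theorem Balanced.append {qs rs : List (List α × List α)} (hqs : Balanced qs) (hrs : Balanced rs) :
    Balanced (qs ++ rs) := by
  simpa only [Balanced, flatMap_append] using Perm.append hqs hrs

theorem Balanced.flatten {rss : List (List (List α × List α))} (h : ∀ rs ∈ rss, Balanced rs) :
    Balanced rss.flatten := by
  induction rss with
  | nil => exact .rfl
  | cons rs rss ih =>
    rw [forall_mem_cons] at h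
    exact h.1.append (ih h.2)

theorem Balanced.perm {qs rs : List (List α × List α)} (hqs : Balanced qs) (h : qs ~ rs) :
    Balanced rs :=
  ((h.flatMap_right _).symm.trans hqs).trans (h.flatMap_right _)

/-- The pairs formed by a period of `X` and a period of `Y`, one of which may be missing. -/
def periodPairs (X Y : LinearCode α) : List (List α × List α) :=
  ([] :: X.2) ×ˢ ([] :: Y.2)

theorem mem_toSet_and_mem_toSet_iff {X Y : LinearCode α} {m : Multiset α} :
    m ∈ X.toSet ∧ m ∈ Y.toSet ↔ ∃ qs ⊆ X.periodPairs Y, Balanced ((X.1, Y.1) :: qs) ∧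
      m = ↑(X.1 ++ qs.flatMap Prod.fst) := by
  constructor
  · rintro ⟨⟨xs, hxs, rfl⟩, ⟨ys, hys, hm⟩⟩
    have hfst : (xs.map (·, ([] : List α)) ++ ys.map (([] : List α), ·)).flatMap Prod.fst
        = xs.flatten := by
      simp [flatMap_map, flatMap_eq_nil_iff.2]
    have hsnd : (xs.map (·, ([] : List α)) ++ ys.map (([] : List α), ·)).flatMap Prod.snd
        = ys.flatten := by
      simp [flatMap_map, flatMap_eq_nil_iff.2]
    refine ⟨xs.map (·, []) ++ ys.map ([], ·), ?_, ?_, by rw [hfst]⟩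
    · refine append_subset.2 ⟨fun p hp => ?_, fun p hp => ?_⟩ <;>
        obtain ⟨z, hz, rfl⟩ := mem_map.1 hp
      exacts [pair_mem_product.2 ⟨mem_cons_of_mem _ (hxs hz), mem_cons_self⟩,
        pair_mem_product.2 ⟨mem_cons_self, mem_cons_of_mem _ (hys hz)⟩]
    · simpa only [Balanced, flatMap_cons, hfst, hsnd, Multiset.coe_eq_coe] using hm
  · rintro ⟨qs, hqs, hbal, rfl⟩
    have hfst : qs.map Prod.fst ⊆ [] :: X.2 := fun x hx => by
      obtain ⟨q, hq, rfl⟩ := mem_map.1 hx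
      exact (mem_product.1 (hqs hq)).1
    have hsnd : qs.map Prod.snd ⊆ [] :: Y.2 := fun y hy => by
      obtain ⟨q, hq, rfl⟩ := mem_map.1 hy
      exact (mem_product.1 (hqs hq)).2
    refine ⟨mem_toSet_of_subset_cons_nil hfst, ?_⟩
    rw [show (↑(X.1 ++ qs.flatMap Prod.fst) : Multiset α) = ↑(Y.1 ++ qs.flatMap Prod.snd) from
      Multiset.coe_eq_coe.2 hbal]
    exact mem_toSet_of_subset_cons_nil hsnd

/-- All the letters of a code, concatenated to a word. -/
def letters (X : LinearCode α) : List α := (X.1 :: X.2).flatten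

theorem length_le_of_mem_cons_nil {X : LinearCode α} {x : List α} (hx : x ∈ X.1 :: [] :: X.2) :
    x.length ≤ X.letters.length ∧ x ⊆ X.letters := by
  have hsub : x <+ X.letters := by
    rcases mem_cons.1 hx with rfl | hx
    · exact sublist_flatten_of_mem mem_cons_self
    · rcases mem_cons.1 hx with rfl | hx
      · exact nil_sublist _
      · exact sublist_flatten_of_mem (mem_cons_of_mem _ hx)
  exact ⟨hsub.length_le, hsub.subset⟩

/-- A bound on the lengths of the irreducible balanced lists of pairs of words of `X` and `Y`. -/
def balanceBound (X Y : LinearCode α) : ℕ :=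
  zeroSumBound (X.letters ++ Y.letters).length (X.letters ++ Y.letters).length

theorem exists_balanced_blocks {ℓ : List α} {ps : List (List α × List α)}
    (hfst : ∀ p ∈ ps, p.1.length ≤ ℓ.length ∧ p.1 ⊆ ℓ)
    (hsnd : ∀ p ∈ ps, p.2.length ≤ ℓ.length ∧ p.2 ⊆ ℓ) (hps : Balanced ps) :
    ∃ rss : List (List (List α × List α)), rss.flatten ~ ps ∧
      ∀ rs ∈ rss, rs.length ≤ zeroSumBound ℓ.length ℓ.length ∧ Balanced rs := by
  classical
  let excess (a : α) (p : List α × List α) : ℤ := p.1.count a - p.2.count a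
  have excess_sum : ∀ (a : α) (qs : List (List α × List α)), (qs.map (excess a)).sum =
      (qs.flatMap Prod.fst).count a - (qs.flatMap Prod.snd).count a := fun a qs => by
    induction qs with
    | nil => simp
    | cons q qs ih => simp only [map_cons, sum_cons, ih, excess, flatMap_cons, count_append]; grind
  have excess_le : ∀ f ∈ ℓ.map excess, ∀ p ∈ ps, |f p| ≤ ℓ.length := by
    simp only [forall_mem_map]
    intro a _ p hp
    have h₁ := (count_le_length (a := a) (l := p.1)).trans (hfst p hp).1
    have h₂ := (count_le_length (a := a) (l := p.2)).trans (hsnd p hp).1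
    rw [abs_le]
    constructor <;> simp only [excess] <;> omega
  obtain ⟨rss, hrss, hblocks⟩ := exists_flatten_perm_forall_sum_eq_zero excess_le <| by
    simp only [forall_mem_map, excess_sum]
    exact fun a _ => by rw [hps.count_eq a, sub_self]
  refine ⟨rss, hrss, fun rs hrs => ?_⟩
  obtain ⟨hlen, hzero⟩ := hblocks rs hrs
  refine ⟨by simpa using hlen, perm_iff_count.2 fun a => ?_⟩
  have hmem : ∀ p ∈ rs, p ∈ ps := fun p hp => hrss.mem_iff.1 (mem_flatten_of_mem hrs hp)
  by_cases ha : a ∈ ℓ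
  · have := hzero _ (mem_map_of_mem ha)
    rw [excess_sum] at this
    omega
  · rw [count_eq_zero_of_not_mem, count_eq_zero_of_not_mem] <;> rw [mem_flatMap] <;>
      rintro ⟨p, hp, hap⟩
    exacts [ha ((hsnd p (hmem p hp)).2 hap), ha ((hfst p (hmem p hp)).2 hap)]

theorem exists_balanced_base_periods {X Y : LinearCode α}
    {qs : List (List α × List α)} (hqs : qs ⊆ X.periodPairs Y)
    (hbal : Balanced ((X.1, Y.1) :: qs)) :
    ∃ (rs : List (List α × List α)) (rss : List (List (List α × List α))),
      rs ++ rss.flatten ~ qs ∧ rs.length ≤ X.balanceBound Y ∧ Balanced ((X.1, Y.1) :: rs) ∧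
      ∀ rs' ∈ rss, rs'.length ≤ X.balanceBound Y ∧ Balanced rs' := by
  have hmem : ∀ p ∈ (X.1, Y.1) :: qs, p.1 ∈ X.1 :: [] :: X.2 ∧ p.2 ∈ Y.1 :: [] :: Y.2 := by
    refine forall_mem_cons.2 ⟨⟨mem_cons_self, mem_cons_self⟩, fun p hp => ?_⟩
    exact (mem_product.1 (hqs hp)).imp (mem_cons_of_mem _) (mem_cons_of_mem _)
  obtain ⟨blocks, hperm, hblocks⟩ := exists_balanced_blocks (ℓ := X.letters ++ Y.letters)
    (fun p hp => (length_le_of_mem_cons_nil (hmem p hp).1).imp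
      (fun h => by rw [length_append]; omega)
      fun h => Subset.trans h (subset_append_left _ _))
    (fun p hp => (length_le_of_mem_cons_nil (hmem p hp).2).imp
      (fun h => by rw [length_append]; omega)
      fun h => Subset.trans h (subset_append_right _ _)) hbal
  obtain ⟨block, hblock, hbase⟩ := mem_flatten.1 (hperm.mem_iff.2 mem_cons_self)
  obtain ⟨blocks₁, blocks₂, rfl⟩ := append_of_mem hblock
  obtain ⟨l₁, l₂, rfl⟩ := append_of_mem hbase
  have hmid : (X.1, Y.1) :: (l₁ ++ l₂) ~ l₁ ++ (X.1, Y.1) :: l₂ := perm_middle.symm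
  refine ⟨l₁ ++ l₂, blocks₁ ++ blocks₂, (perm_cons (X.1, Y.1)).1 (Perm.trans ?_ hperm), ?_,
    (hblocks _ hblock).2.perm hmid.symm, fun rs hrs => hblocks rs ?_⟩
  · refine Perm.trans (hmid.append_right _) ?_
    simpa using (perm_append_comm_assoc (l₁ ++ (X.1, Y.1) :: l₂) blocks₁.flatten blocks₂.flatten)
  · have := (hblocks _ hblock).1
    rw [← hmid.length_eq, length_cons] at this
    exact (Nat.le_succ _).trans this
  · rw [mem_append, mem_cons]
    exact (mem_append.1 hrs).imp id .inr

variable [DecidableEq α]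

/-- Codes for the intersection of two linear sets, as a finite union of linear sets. -/
def inter (X Y : LinearCode α) : List (LinearCode α) :=
  let blocks := boundedLists (X.periodPairs Y) (X.balanceBound Y)
  (blocks.filter fun qs => Balanced ((X.1, Y.1) :: qs)).map fun qs =>
    (X.1 ++ qs.flatMap Prod.fst,
      (blocks.filter fun rs => Balanced rs).map fun rs => rs.flatMap Prod.fst)

theorem exists_mem_inter_iff {X Y : LinearCode α} {m : Multiset α} :
    (∃ Z ∈ X.inter Y, m ∈ Z.toSet) ↔ m ∈ X.toSet ∧ m ∈ Y.toSet := by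
  rw [mem_toSet_and_mem_toSet_iff]
  simp only [inter, mem_map, exists_exists_and_eq_and, mem_filter, mem_boundedLists,
    decide_eq_true_eq]
  have flatMap_flatten : ∀ rss : List (List (List α × List α)),
      (rss.map fun rs => rs.flatMap Prod.fst).flatten = rss.flatten.flatMap Prod.fst := by
    intro rss
    rw [flatten_eq_flatMap, flatMap_map, flatten_eq_flatMap, flatMap_assoc]; rfl
  constructor
  · rintro ⟨rs, ⟨⟨-, hrs⟩, hbal⟩, zs, hzs, rfl⟩
    obtain ⟨rss, hrss, rfl⟩ := exists_subset_map_eq hzs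
    have hperiods := fun rs' (h : rs' ∈ rss) => mem_filter.1 (hrss h)
    refine ⟨rs ++ rss.flatten, append_subset.2 ⟨hrs, fun p hp => ?_⟩, ?_, ?_⟩
    · obtain ⟨rs', hrs', hp⟩ := mem_flatten.1 hp
      exact (mem_boundedLists.1 (hperiods rs' hrs').1).2 hp
    · exact hbal.append (.flatten fun rs' h => of_decide_eq_true (hperiods rs' h).2)
    · rw [flatMap_flatten, flatMap_append, append_assoc]
  · rintro ⟨qs, hqs, hbal, rfl⟩
    obtain ⟨rs, rss, hperm, hrs, hbal, hrss⟩ := exists_balanced_base_periods hqs hbal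
    have hsub : rs ++ rss.flatten ⊆ X.periodPairs Y := Subset.trans hperm.subset hqs
    rw [append_subset] at hsub
    refine ⟨rs, ⟨⟨hrs, hsub.1⟩, hbal⟩, rss.map fun rs => rs.flatMap Prod.fst,
      map_subset _ fun rs' h => ?_, ?_⟩
    · rw [mem_filter, mem_boundedLists, decide_eq_true_eq]
      exact ⟨⟨(hrss rs' h).1, fun p hp => hsub.2 (mem_flatten_of_mem h hp)⟩, (hrss rs' h).2⟩
    · rw [flatMap_flatten, append_assoc, ← flatMap_append, Multiset.coe_eq_coe]
      exact (hperm.flatMap_right _).symm.append_left _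

end LinearCode

section Profile

variable {α : Type*} [DecidableEq α]

/-- The profile of an infinite word consists of the set of letters that occur infinitely often and
the multiset of occurrences of the other letters. -/
abbrev Profile (α : Type*) : Type _ := Finset α × Multiset α

/-- A description of a set of profiles: a list of the letters that occur infinitely often, and a
linear set of multisets. -/
abbrev ProfileCode (α : Type*) : Type _ := List α × LinearCode α

/-- The set of profiles described by a list of codes, as a finite union. -/
def profiles (Γ : List (ProfileCode α)) : Set (Profile α) :=
  {p | ∃ γ ∈ Γ, γ.1.toFinset = p.1 ∧ p.2 ∈ γ.2.toSet}

/-- Codes for the intersection of two sets of profiles. -/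
def interCodes (Γ Δ : List (ProfileCode α)) : List (ProfileCode α) :=
  ((Γ ×ˢ Δ).filter fun q => q.1.1.toFinset = q.2.1.toFinset).flatMap fun q =>
    (q.1.2.inter q.2.2).map (Prod.mk q.1.1)

theorem profiles_interCodes (Γ Δ : List (ProfileCode α)) :
    profiles (interCodes Γ Δ) = profiles Γ ∩ profiles Δ := by
  ext ⟨S, m⟩
  simp only [profiles, interCodes, Set.mem_inter_iff, Set.mem_ofPred_eq, mem_flatMap, mem_filter,
    mem_map, decide_eq_true_eq]
  constructor
  · rintro ⟨_, ⟨⟨γ, δ⟩, ⟨hmem, hγδ⟩, Z, hZ, rfl⟩, rfl, hm⟩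
    obtain ⟨hmγ, hmδ⟩ := LinearCode.exists_mem_inter_iff.1 ⟨Z, hZ, hm⟩
    obtain ⟨hγ, hδ⟩ := pair_mem_product.1 hmem
    exact ⟨⟨γ, hγ, rfl, hmγ⟩, δ, hδ, hγδ.symm, hmδ⟩
  · rintro ⟨⟨γ, hγ, rfl, hmγ⟩, δ, hδ, hδγ, hmδ⟩
    obtain ⟨Z, hZ, hm⟩ := LinearCode.exists_mem_inter_iff.2 ⟨hmγ, hmδ⟩
    exact ⟨(γ.1, Z), ⟨(γ, δ), ⟨pair_mem_product.2 ⟨hγ, hδ⟩, hδγ.symm⟩, Z, hZ, rfl⟩, rfl, hm⟩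

end Profile

/-! ### Profiles of infinite words -/

section Parikh

open scoped Stream'

variable {α : Type*}

theorem parikh_eq_top_iff {w : ℕ → α} {a : α} :
    parikh w a = ⊤ ↔ ∀ N, ∃ i, N ≤ i ∧ w i = a := by
  rw [parikh, Set.encard_eq_top_iff]
  exact Nat.frequently_atTop_iff_infinite.symm.trans Filter.frequently_atTop

theorem parikh_eq_zero_iff {w : ℕ → α} {a : α} : parikh w a = 0 ↔ ∀ i, w i ≠ a := by
  rw [parikh, Set.encard_eq_zero, Set.eq_empty_iff_forall_notMem]
  rfl

theorem mem_take_drop_iff {w : Stream' α} {i n : ℕ} {a : α} :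
    a ∈ (w.drop i).take n ↔ ∃ j, i ≤ j ∧ j < i + n ∧ w j = a := by
  induction n with
  | zero => simp only [Stream'.take_zero, not_mem_nil, false_iff]; grind
  | succ n ih =>
    rw [Stream'.take_succ', mem_append, ih, mem_singleton, Stream'.get_drop]
    change _ ∨ a = w (i + n) ↔ _
    grind

variable [DecidableEq α]

theorem parikh_cons (a b : α) (w : Stream' α) :
    parikh (Stream'.cons a w) b = (if a = b then 1 else 0) + parikh w b := by
  have hset : {i | Stream'.cons a w i = b} =
      (if a = b then {0} else ∅) ∪ Nat.succ '' {i | w i = b} := by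
    ext i
    cases i <;> by_cases hab : a = b <;> simp [Stream'.cons, hab]
  unfold parikh
  rw [hset, Set.encard_union_eq, Nat.succ_injective.encard_image]
  · split_ifs <;> simp
  · split_ifs <;> simp

theorem parikh_append (x : List α) (w : Stream' α) (a : α) :
    parikh (x ++ₛ w) a = x.count a + parikh w a := by
  induction x with
  | nil => simp
  | cons b x ih =>
    rw [Stream'.cons_append_stream, parikh_cons, ih, count_cons]
    by_cases hab : b = a <;> simp [hab, add_assoc, add_left_comm]

/-- The infinite repetition of a nonempty word. -/
def periodicWord {α : Type*} (r : List α) (hr : r ≠ []) : Stream' α := fun i =>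
  r[i % r.length]'(Nat.mod_lt _ (length_pos_iff.2 hr))

theorem parikh_periodicWord (r : List α) (hr : r ≠ []) (a : α) :
    parikh (periodicWord r hr) a = if a ∈ r then ⊤ else 0 := by
  split_ifs with ha
  · obtain ⟨j, hj, rfl⟩ := getElem_of_mem ha
    refine parikh_eq_top_iff.2 fun N => ⟨r.length * N + j, ?_, ?_⟩
    · have := Nat.le_mul_of_pos_left N (length_pos_iff.2 hr)
      omega
    · simp [periodicWord, Nat.mod_eq_of_lt hj]
  · refine parikh_eq_zero_iff.2 fun i hi => ha ?_
    rw [← hi]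
    exact getElem_mem _

/-- The profile of the infinite word `w` is `p`. The second condition makes `p` unique: the
multiplicities in `p.2` of letters of `p.1` would play no role in the first one. -/
def IsProfile (w : ℕ → α) (p : Profile α) : Prop :=
  (∀ a, parikh w a = if a ∈ p.1 then ⊤ else (p.2.count a : ℕ∞)) ∧ ∀ a ∈ p.2, a ∉ p.1

theorem IsProfile.of_parikh_eq {w w' : ℕ → α} {p : Profile α} (hw : IsProfile w p)
    (h : parikh w' = parikh w) : IsProfile w' p :=
  ⟨fun a => by rw [h, hw.1 a], hw.2⟩

theorem exists_isProfile {w : ℕ → α} (hw : (Set.range w).Finite) : ∃ p, IsProfile w p := by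
  classical
  let S : Finset α := {a ∈ hw.toFinset | parikh w a = ⊤}
  let T : Finset α := {a ∈ hw.toFinset | parikh w a ≠ ⊤}
  have hzero : ∀ a, a ∉ hw.toFinset → parikh w a = 0 := fun a ha =>
    parikh_eq_zero_iff.2 fun i hi => ha (hw.mem_toFinset.2 ⟨i, hi⟩)
  have hS : ∀ a, a ∈ S ↔ parikh w a = ⊤ := fun a =>
    Finset.mem_filter.trans <| and_iff_right_of_imp fun h => by_contra fun ha => by
      simp [hzero a ha] at h
  refine ⟨(S, ∑ a ∈ T, Multiset.replicate (parikh w a).toNat a), fun a => ?_, fun a ha => ?_⟩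
  · split_ifs with haS
    · exact (hS a).1 haS
    · have hsum : (∑ b ∈ T, Multiset.replicate (parikh w b).toNat b).count a =
          (parikh w a).toNat := by
        simp only [Multiset.count_sum', Multiset.count_replicate, eq_comm (b := a),
          Finset.sum_ite_eq]
        rw [ite_eq_left_iff]
        intro haT
        rw [hzero a fun ha => haT (Finset.mem_filter.2 ⟨ha, fun h => haS ((hS a).2 h)⟩)]
        rfl
      rw [hsum, ENat.natCast_toNat fun h => haS ((hS a).2 h)]
  · obtain ⟨b, hb, hab⟩ := Multiset.mem_sum.1 ha
    rw [Multiset.eq_of_mem_replicate hab, hS]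
    exact (Finset.mem_filter.1 hb).2

theorem IsProfile.eventually_mem {w : ℕ → α} {p : Profile α} (hw : IsProfile w p) :
    ∃ N, ∀ i, N ≤ i → w i ∈ p.1 := by
  have hfin : {i | w i ∉ p.1}.Finite := by
    refine (p.2.toFinset.finite_toSet.biUnion (t := fun a => {i | w i = a ∧ a ∉ p.1})
      fun a _ => ?_).subset fun i hi => ?_
    · by_cases ha : a ∈ p.1
      · simp [ha]
      · have hcount := hw.1 a
        rw [if_neg ha] at hcount
        exact (Set.finite_of_encard_eq_coe hcount).subset fun i hi => hi.1
    · have hpos : parikh w (w i) ≠ 0 := fun h => parikh_eq_zero_iff.1 h i rfl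
      rw [hw.1, if_neg hi, Nat.cast_ne_zero, Multiset.count_ne_zero] at hpos
      exact Set.mem_biUnion (Multiset.mem_toFinset.2 hpos) ⟨rfl, hi⟩
  obtain ⟨N, hN⟩ := hfin.bddAbove
  exact ⟨N + 1, fun i hi => by_contra fun h => absurd (hN h) (by omega)⟩

theorem IsProfile.filter_take_eq {w : Stream' α} {p : Profile α} (hw : IsProfile w p)
    {n : ℕ} (hn : ∀ i, n ≤ i → w i ∈ p.1) :
    (((w.take n).filter (· ∉ p.1) : List α) : Multiset α) = p.2 := by
  ext a
  rw [Multiset.coe_count]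
  by_cases ha : a ∈ p.1
  · rw [Multiset.count_eq_zero_of_notMem fun h => hw.2 a h ha, count_eq_zero]
    simp [ha]
  · have hcount := hw.1 a
    have hzero : parikh (w.drop n) a = 0 :=
      parikh_eq_zero_iff.2 fun i hi => ha (hi ▸ hn (i + n) (by omega))
    rw [← Stream'.append_take_drop n w, parikh_append, hzero, if_neg ha, add_zero,
      Nat.cast_inj] at hcount
    rw [← hcount, count_filter (by simpa using ha)]

theorem IsProfile.exists_toFinset_take_drop_eq {w : Stream' α} {p : Profile α} (hw : IsProfile w p)
    {n : ℕ} (hn : ∀ i, n ≤ i → w i ∈ p.1) :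
    ∃ N, ∀ k, N ≤ k → ((w.drop n).take k).toFinset = p.1 := by
  have hocc : ∀ a ∈ p.1, ∃ i, n ≤ i ∧ w i = a := fun a ha =>
    parikh_eq_top_iff.1 (by rw [hw.1, if_pos ha]) n
  choose! position hposition using hocc
  refine ⟨p.1.sup position + 1, fun k hk => Finset.ext fun a => ?_⟩
  rw [mem_toFinset, mem_take_drop_iff]
  constructor
  · rintro ⟨j, hj, -, rfl⟩
    exact hn j hj
  · intro ha
    have := Finset.le_sup (f := position) ha
    exact ⟨position a, (hposition a ha).1, by omega, (hposition a ha).2⟩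

end Parikh

section Buchi

open scoped Stream'

variable {α : Type*} {Q : Type*} {M : NFA α Q}

theorem mem_evalFrom_cons {p q : Q} {a : α} {x : List α} :
    q ∈ M.evalFrom {p} (a :: x) ↔ ∃ p' ∈ M.step p a, q ∈ M.evalFrom {p'} x := by
  rw [NFA.evalFrom_cons, NFA.stepSet_singleton, NFA.mem_evalFrom_iff_exists]

theorem mem_evalFrom_append {p q : Q} {x y : List α} :
    q ∈ M.evalFrom {p} (x ++ y) ↔ ∃ p' ∈ M.evalFrom {p} x, q ∈ M.evalFrom {p'} y := by
  rw [NFA.evalFrom_append, NFA.mem_evalFrom_iff_exists]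

theorem mem_eval_iff {q : Q} {x : List α} :
    q ∈ M.eval x ↔ ∃ p ∈ M.start, q ∈ M.evalFrom {p} x :=
  NFA.mem_evalFrom_iff_exists

/-- `M` has a run on the infinite word `w` from `p` that visits `q` infinitely often. -/
def HasRunFrom (M : NFA α Q) (p q : Q) (w : ℕ → α) : Prop :=
  ∃ ρ : ℕ → Q, ρ 0 = p ∧ (∀ i, ρ (i + 1) ∈ M.step (ρ i) (w i)) ∧ q ∈ infStates ρ

theorem HasRunFrom.append {p p' q : Q} {x : List α} {w : Stream' α} (hx : p' ∈ M.evalFrom {p} x)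
    (hw : HasRunFrom M p' q w) : HasRunFrom M p q (x ++ₛ w) := by
  induction x generalizing p with
  | nil =>
    rw [NFA.evalFrom_nil, Set.mem_singleton_iff] at hx
    exact hx ▸ hw
  | cons a x ih =>
    obtain ⟨p₁, hp₁, hx⟩ := mem_evalFrom_cons.1 hx
    obtain ⟨ρ, rfl, hρ, hq⟩ := ih hx
    refine ⟨Stream'.cons p ρ, rfl, fun i => ?_, fun i => ?_⟩
    · cases i with
      | zero => exact hp₁
      | succ i => exact hρ i
    · obtain ⟨j, hij, hj⟩ := hq i
      exact ⟨j + 1, by omega, hj⟩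

theorem exists_states_of_mem_evalFrom {p q : Q} {x : List α} (hx : q ∈ M.evalFrom {p} x) :
    ∃ σ : ℕ → Q, σ 0 = p ∧ σ x.length = q ∧
      ∀ (i : ℕ) (hi : i < x.length), σ (i + 1) ∈ M.step (σ i) x[i] := by
  induction x generalizing p with
  | nil => exact ⟨fun _ => p, rfl, (by simpa using hx.symm), by simp⟩
  | cons a x ih =>
    obtain ⟨p', hp', hx⟩ := mem_evalFrom_cons.1 hx
    obtain ⟨σ, rfl, rfl, hσ⟩ := ih hx
    refine ⟨Stream'.cons p σ, rfl, rfl, fun i hi => ?_⟩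
    cases i with
    | zero => exact hp'
    | succ i => exact hσ i (Nat.lt_of_succ_lt_succ hi)

theorem HasRunFrom.periodic {q : Q} {r : List α} (hr : r ≠ []) (hq : q ∈ M.evalFrom {q} r) :
    HasRunFrom M q q (periodicWord r hr) := by
  obtain ⟨σ, hσ₀, hσ₁, hσ⟩ := exists_states_of_mem_evalFrom hq
  have hpos := length_pos_iff.2 hr
  refine ⟨fun i => σ (i % r.length), by simpa using hσ₀, fun i => ?_, fun i => ?_⟩
  · have hstep := hσ (i % r.length) (Nat.mod_lt i hpos)
    rcases Nat.lt_or_ge (i % r.length + 1) r.length with hlt | hge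
    · rwa [← Nat.mod_eq_of_lt hlt, Nat.mod_add_mod] at hstep
    · have hlast : i % r.length + 1 = r.length := le_antisymm (Nat.mod_lt i hpos) hge
      have hwrap : (i + 1) % r.length = 0 := by rw [← Nat.mod_add_mod, hlast, Nat.mod_self]
      simp only [hwrap]
      rwa [hlast, hσ₁, ← hσ₀] at hstep
  · refine ⟨r.length * (i + 1), ?_, by simpa using hσ₀⟩
    have := Nat.le_mul_of_pos_left (i + 1) hpos
    omega

theorem mem_evalFrom_take_drop {w : Stream' α} {ρ : ℕ → Q}
    (hρ : ∀ i, ρ (i + 1) ∈ M.step (ρ i) (w i)) (i n : ℕ) :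
    ρ (i + n) ∈ M.evalFrom {ρ i} ((w.drop i).take n) := by
  induction n with
  | zero => simp
  | succ n ih =>
    rw [Stream'.take_succ', Stream'.get_drop, mem_evalFrom_append]
    refine ⟨ρ (i + n), ih, ?_⟩
    rw [NFA.evalFrom_singleton, NFA.stepSet_singleton]
    exact hρ (i + n)

variable [DecidableEq α]

/-- The profiles of the words accepted by `M` under the Büchi condition, in terms of finite runs:
an initial run to an accepting state `q` and a loop at `q`. -/
def acceptedProfiles (M : NFA α Q) : Set (Profile α) :=
  {p | ∃ q ∈ M.accept, ∃ x r, q ∈ M.eval x ∧ q ∈ M.evalFrom {q} r ∧ r ≠ [] ∧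
    r.toFinset = p.1 ∧ ((x.filter (· ∉ p.1) : List α) : Multiset α) = p.2}

theorem mem_acceptedProfiles_of_mem_buchiLanguage {w : ℕ → α} {p : Profile α} (hp : IsProfile w p)
    (hw : w ∈ buchiLanguage M) : p ∈ acceptedProfiles M := by
  obtain ⟨ρ, ⟨hstart, hρ⟩, q, hq, haccept⟩ := hw
  obtain ⟨N, hN⟩ := hp.eventually_mem
  obtain ⟨i, hNi, rfl⟩ := hq N
  have hi : ∀ j, i ≤ j → w j ∈ p.1 := fun j hj => hN j (by omega)
  obtain ⟨K, hK⟩ := hp.exists_toFinset_take_drop_eq hi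
  obtain ⟨j, hij, hj⟩ := hq (i + K)
  refine ⟨ρ i, haccept, Stream'.take i w, (Stream'.drop i w).take (j - i),
    mem_eval_iff.2 ⟨ρ 0, hstart, ?_⟩, ?_, ?_, hK _ (by omega), hp.filter_take_eq hi⟩
  · have hinitial := mem_evalFrom_take_drop hρ 0 i
    rwa [zero_add] at hinitial
  · have hloop := mem_evalFrom_take_drop hρ i (j - i)
    rwa [show i + (j - i) = j by omega, hj] at hloop
  · refine ne_nil_of_length_pos ?_
    rw [Stream'.length_take]
    omega

theorem exists_isProfile_mem_buchiLanguage {p : Profile α} (hp : p ∈ acceptedProfiles M)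
    (hdisj : ∀ a ∈ p.2, a ∉ p.1) : ∃ w, IsProfile w p ∧ w ∈ buchiLanguage M := by
  obtain ⟨q, haccept, x, r, hx, hq, hr, hrS, hxm⟩ := hp
  obtain ⟨q₀, hq₀, hx⟩ := mem_eval_iff.1 hx
  obtain ⟨ρ, hρ₀, hρ, hinf⟩ := (HasRunFrom.periodic hr hq).append hx
  refine ⟨_, ⟨fun a => ?_, hdisj⟩, ρ, ⟨hρ₀ ▸ hq₀, hρ⟩, q, hinf, haccept⟩
  rw [parikh_append, parikh_periodicWord, ← hxm, ← hrS, Multiset.coe_count]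
  by_cases ha : a ∈ r <;> simp [ha, count_filter]

theorem mem_jumpingLanguage_iff {w : ℕ → α} {p : Profile α} (hp : IsProfile w p) :
    w ∈ jumpingLanguage M ↔ p ∈ acceptedProfiles M := by
  constructor
  · rintro ⟨w', hw', haccept⟩
    exact mem_acceptedProfiles_of_mem_buchiLanguage (hp.of_parikh_eq hw') haccept
  · intro h
    obtain ⟨w', hw', haccept⟩ := exists_isProfile_mem_buchiLanguage h hp.2
    exact ⟨w', funext fun a => by rw [hw'.1, hp.1], haccept⟩

end Buchi

/-! ### Reduction of walks -/

/-- The transitions of an automaton, as triples of source, letter and target. -/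
abbrev Edge (V α : Type*) : Type _ := V × α × V

namespace Edge

variable {V α : Type*}

/-- The list `l` of transitions is a walk from `p` to `q`. -/
def IsWalk : V → List (Edge V α) → V → Prop
  | p, [], q => p = q
  | p, e :: l, q => e.1 = p ∧ IsWalk e.2.2 l q

/-- The word read along a list of transitions. -/
def word (l : List (Edge V α)) : List α := l.map fun e => e.2.1

/-- The vertices visited by a walk `l` starting at `p`. -/
def support (p : V) (l : List (Edge V α)) : List V := p :: l.map fun e => e.2.2

variable {p q s : V} {c l w x y : List (Edge V α)}

theorem isWalk_append : IsWalk p (x ++ y) q ↔ ∃ s, IsWalk p x s ∧ IsWalk s y q := by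
  induction x generalizing p with
  | nil => simp [IsWalk]
  | cons e x ih => simp [IsWalk, ih, and_assoc]

theorem support_subset (h : x ⊆ y) : support p x ⊆ support p y :=
  cons_subset_cons p (map_subset _ h)

theorem IsWalk.end_mem_support (h : IsWalk p l q) : q ∈ support p l := by
  induction l generalizing p with
  | nil => exact mem_singleton.2 h.symm
  | cons e l ih => exact mem_cons_of_mem p (ih h.2)

theorem IsWalk.exists_append_of_mem_support (h : IsWalk p l q) (hs : s ∈ support p l) :
    ∃ x y, l = x ++ y ∧ IsWalk p x s ∧ IsWalk s y q := by
  rcases mem_cons.1 hs with rfl | hs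
  · exact ⟨[], l, rfl, rfl, h⟩
  · induction l generalizing p with
    | nil => simp at hs
    | cons e l ih =>
      rcases mem_cons.1 hs with rfl | hs
      · exact ⟨[e], l, rfl, ⟨h.1, rfl⟩, h.2⟩
      · obtain ⟨x, y, rfl, hx, hy⟩ := ih h.2 (mem_cons_of_mem _ hs) hs
        exact ⟨e :: x, y, rfl, ⟨h.1, hx⟩, hy⟩

theorem IsWalk.exists_perm_append (hw : IsWalk p w q) (hs : s ∈ support p w) (hc : IsWalk s c s) :
    ∃ l, l ~ c ++ w ∧ IsWalk p l q := by
  obtain ⟨x, y, rfl, hx, hy⟩ := hw.exists_append_of_mem_support hs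
  exact ⟨x ++ (c ++ y), perm_append_comm_assoc x c y,
    isWalk_append.2 ⟨s, hx, isWalk_append.2 ⟨s, hc, hy⟩⟩⟩

theorem IsWalk.exists_perm_append_flatten (hw : IsWalk p w q) {cs : List (List (Edge V α))}
    (hcs : ∀ c ∈ cs, ∃ s ∈ support p w, IsWalk s c s) :
    ∃ l, l ~ w ++ cs.flatten ∧ IsWalk p l q := by
  induction cs with
  | nil => exact ⟨w, by simp, hw⟩
  | cons c cs ih =>
    rw [forall_mem_cons] at hcs
    obtain ⟨l, hlw, hl⟩ := ih hcs.2
    obtain ⟨s, hs, hc⟩ := hcs.1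
    obtain ⟨l', hll', hl'⟩ := hl.exists_perm_append
      (support_subset (Subset.trans (subset_append_left _ _) hlw.symm.subset) hs) hc
    exact ⟨l', (hll'.trans (hlw.append_left c)).trans (perm_append_comm_assoc c w _), hl'⟩

theorem IsWalk.nodup_support_or_exists_cycle (h : IsWalk p l q) :
    (support p l).Nodup ∨ ∃ x c y s, l = x ++ (c ++ y) ∧ IsWalk p x s ∧ IsWalk s c s ∧
      IsWalk s y q ∧ c ≠ [] ∧ (c.map fun e => e.2.2).Nodup := by
  induction l generalizing p with
  | nil => exact .inl (nodup_singleton p)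
  | cons e l ih =>
    obtain ⟨rfl, hl⟩ := h
    rcases ih hl with hnodup | ⟨x, c, y, s, rfl, hx, hc⟩
    · by_cases hmem : e.1 ∈ support e.2.2 l
      · obtain ⟨x, y, rfl, hx, hy⟩ := hl.exists_append_of_mem_support hmem
        refine .inr ⟨[], e :: x, y, e.1, rfl, rfl, ⟨rfl, hx⟩, hy, by simp, ?_⟩
        rw [support, map_append, ← cons_append] at hnodup
        exact hnodup.of_append_left
      · exact .inl (nodup_cons.2 ⟨hmem, hnodup⟩)
    · exact .inr ⟨e :: x, c, y, s, rfl, ⟨rfl, hx⟩, hc⟩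

theorem length_le_card_of_nodup_targets {U : Finset V} (hU : ∀ e ∈ c, e.2.2 ∈ U)
    (hc : (c.map fun e => e.2.2).Nodup) : c.length ≤ U.card := by
  classical
  rw [← length_map (as := c), ← toFinset_card_of_nodup hc]
  exact Finset.card_le_card fun v hv => by
    obtain ⟨e, he, rfl⟩ := mem_map.1 (mem_toFinset.1 hv)
    exact hU e he

variable [DecidableEq V] [DecidableEq α] {U : Finset V}

/-- `w` is a walk from `p` to `q` of bounded length that has the same transitions as the walk `l`,
and `cs` are short cycles at vertices of `w` that make up for the difference. -/
structure IsReduction (U : Finset V) (p q : V) (l w : List (Edge V α))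
    (cs : List (List (Edge V α))) : Prop where
  isWalk : IsWalk p w q
  perm : w ++ cs.flatten ~ l
  length_le : w.length ≤ w.toFinset.card * U.card
  isCycle : ∀ c ∈ cs, c.length ≤ U.card ∧ c ⊆ w ∧ ∃ s ∈ support p w, IsWalk s c s

theorem IsReduction.subset {cs : List (List (Edge V α))} (h : IsReduction U p q l w cs) :
    l ⊆ w := fun e he => by
  rcases mem_append.1 (h.perm.mem_iff.2 he) with he | he
  · exact he
  · obtain ⟨c, hc, he⟩ := mem_flatten.1 he
    exact (h.isCycle c hc).2.1 he

theorem IsReduction.cons_of_subset {cs : List (List (Edge V α))}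
    (h : IsReduction U p q (x ++ y) w cs) (hc : IsWalk s c s) (hne : c ≠ [])
    (hlen : c.length ≤ U.card) (hcw : c ⊆ w) : IsReduction U p q (x ++ (c ++ y)) w (c :: cs) where
  isWalk := h.isWalk
  perm := calc
    w ++ (c ++ cs.flatten) ~ c ++ (w ++ cs.flatten) := perm_append_comm_assoc w c _
    _ ~ c ++ (x ++ y) := h.perm.append_left c
    _ ~ x ++ (c ++ y) := perm_append_comm_assoc c x y
  length_le := h.length_le
  isCycle := by
    refine forall_mem_cons.2 ⟨⟨hlen, hcw, s, mem_cons_of_mem p (map_subset _ hcw ?_), hc⟩,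
      h.isCycle⟩
    obtain ⟨e, c, rfl⟩ := exists_cons_of_ne_nil hne
    exact IsWalk.end_mem_support hc.2

theorem IsReduction.exists_of_not_subset {cs : List (List (Edge V α))}
    (h : IsReduction U p q (x ++ y) w cs) (hs : s ∈ support p x) (hc : IsWalk s c s)
    (hlen : c.length ≤ U.card) (hcw : ¬c ⊆ w) :
    ∃ w', IsReduction U p q (x ++ (c ++ y)) w' cs := by
  obtain ⟨w', hperm, hw'⟩ := h.isWalk.exists_perm_append
    (support_subset (Subset.trans (subset_append_left x y) h.subset) hs) hc
  have hsub : w ⊆ w' := Subset.trans (subset_append_right c w) hperm.symm.subset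
  refine ⟨w', hw', ?_, ?_, fun c' hc' => ?_⟩
  · calc w' ++ cs.flatten ~ c ++ w ++ cs.flatten := hperm.append_right _
      _ = c ++ (w ++ cs.flatten) := append_assoc ..
      _ ~ c ++ (x ++ y) := h.perm.append_left c
      _ ~ x ++ (c ++ y) := perm_append_comm_assoc c x y
  · have hssub : w.toFinset ⊂ w'.toFinset := by
      refine ⟨fun e he => mem_toFinset.2 (hsub (mem_toFinset.1 he)),
        fun hsub' => hcw fun e he => ?_⟩
      exact mem_toFinset.1 (hsub' (mem_toFinset.2 (hperm.mem_iff.2 (mem_append_left w he))))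
    calc w'.length = w.length + c.length := by rw [hperm.length_eq, length_append, add_comm]
      _ ≤ w.toFinset.card * U.card + U.card := add_le_add h.length_le hlen
      _ = (w.toFinset.card + 1) * U.card := (Nat.succ_mul _ _).symm
      _ ≤ w'.toFinset.card * U.card := Nat.mul_le_mul_right _ (Finset.card_lt_card hssub)
  · obtain ⟨hlen, hcw, s, hs, hc⟩ := h.isCycle c' hc'
    exact ⟨hlen, Subset.trans hcw hsub, s, support_subset hsub hs, hc⟩

theorem IsWalk.exists_isReduction (h : IsWalk p l q) (hU : ∀ e ∈ l, e.2.2 ∈ U) :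
    ∃ w cs, IsReduction U p q l w cs := by
  induction hn : l.length using Nat.strong_induction_on generalizing l with
  | _ n ih =>
    rcases h.nodup_support_or_exists_cycle with hnodup | ⟨x, c, y, s, rfl, hx, hc, hy, hne, hnodup⟩
    · have hlen := length_le_card_of_nodup_targets hU (nodup_cons.1 hnodup).2
      refine ⟨l, [], h, by simp, ?_, by simp⟩
      rcases eq_or_ne l [] with rfl | hl
      · simp
      · exact hlen.trans (Nat.le_mul_of_pos_left _
          (Finset.card_pos.2 ((toFinset_nonempty_iff l).2 hl)))
    · simp only [mem_append] at hU
      have hlen := length_le_card_of_nodup_targets (fun e he => hU e (by simp [he])) hnodup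
      obtain ⟨w, cs, hw⟩ := ih (x ++ y).length
        (by have := length_pos_iff.2 hne; simp only [length_append] at hn ⊢; omega)
        (isWalk_append.2 ⟨s, hx, hy⟩) (fun e he => hU e (by simp_all only [mem_append]; tauto)) rfl
      by_cases hcw : c ⊆ w
      · exact ⟨w, c :: cs, hw.cons_of_subset hc hne hlen hcw⟩
      · obtain ⟨w', hw'⟩ := hw.exists_of_not_subset hx.end_mem_support hc hlen hcw
        exact ⟨w', cs, hw'⟩

end Edge

/-! ### The profiles accepted by an automaton -/

section EdgeAutomata

variable {V α : Type*}

/-- The automaton with transitions `E`, initial states `I` and accepting states `F`. -/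
def edgeNFA (E : List (Edge V α)) (I F : List V) : NFA α V where
  step q a := {q' | (q, a, q') ∈ E}
  start := {q | q ∈ I}
  accept := {q | q ∈ F}

variable {E : List (Edge V α)} {I F : List V}

theorem mem_evalFrom_edgeNFA_iff {p q : V} {x : List α} :
    q ∈ (edgeNFA E I F).evalFrom {p} x ↔ ∃ l ⊆ E, Edge.IsWalk p l q ∧ Edge.word l = x := by
  induction x generalizing p with
  | nil =>
    rw [NFA.evalFrom_nil, Set.mem_singleton_iff]
    constructor
    · rintro rfl
      exact ⟨[], nil_subset E, rfl, rfl⟩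
    · rintro ⟨l, -, hl, hx⟩
      rw [Edge.word, map_eq_nil_iff] at hx
      subst hx
      exact hl.symm
  | cons a x ih =>
    simp only [mem_evalFrom_cons, ih]
    constructor
    · rintro ⟨s, hs, l, hlE, hl, rfl⟩
      exact ⟨(p, a, s) :: l, cons_subset.2 ⟨hs, hlE⟩, ⟨rfl, hl⟩, rfl⟩
    · rintro ⟨l, hlE, hl, hx⟩
      obtain ⟨⟨p', a', s⟩, l, rfl, rfl, rfl⟩ := map_eq_cons_iff.1 hx
      rw [cons_subset] at hlE
      obtain ⟨rfl, hl⟩ := hl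
      exact ⟨s, hlE.1, l, hlE.2, hl, rfl⟩

namespace Edge

theorem filter_word_append_flatten [DecidableEq α] (S : List α) (w : List (Edge V α))
    (cs : List (List (Edge V α))) :
    (word w).filter (· ∉ S) ++ (cs.map fun c => (word c).filter (· ∉ S)).flatten =
      (word (w ++ cs.flatten)).filter (· ∉ S) := by
  simp only [word, map_append, filter_append, map_flatten, filter_flatten, map_map,
    Function.comp_def]

variable [DecidableEq V]

instance decidableIsWalk : ∀ (p : V) (l : List (Edge V α)) (q : V), Decidable (IsWalk p l q)
  | p, [], q => inferInstanceAs (Decidable (p = q))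
  | p, e :: l, q =>
    have := decidableIsWalk e.2.2 l q
    inferInstanceAs (Decidable (e.1 = p ∧ IsWalk e.2.2 l q))

/-- The short closed walks with transitions in `E` at the vertices of the walk `w` from `p`. -/
def closedWalksAt (E : List (Edge V α)) (p : V) (w : List (Edge V α)) : List (List (Edge V α)) :=
  (boundedLists E E.length).filter fun c => ∃ s ∈ support p w, IsWalk s c s

theorem mem_closedWalksAt {p : V} {w c : List (Edge V α)} :
    c ∈ closedWalksAt E p w ↔
      (c.length ≤ E.length ∧ c ⊆ E) ∧ ∃ s ∈ support p w, IsWalk s c s := by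
  rw [closedWalksAt, mem_filter, mem_boundedLists, decide_eq_true_eq]

theorem IsWalk.exists_isReduction_of_subset {p q : V} {l : List (Edge V α)} (h : IsWalk p l q)
    (hl : l ⊆ E) : ∃ w ∈ boundedLists E (E.length * E.length), IsWalk p w q ∧ l ⊆ w ∧ w ⊆ l ∧
      ∃ cs ⊆ closedWalksAt E p w, w ++ cs.flatten ~ l := by
  classical
  let U : Finset V := (E.map fun e => e.2.2).toFinset
  have hU : U.card ≤ E.length := (toFinset_card_le _).trans (length_map ..).le
  obtain ⟨w, cs, hw⟩ := h.exists_isReduction (U := U) fun e he =>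
    mem_toFinset.2 (mem_map_of_mem (hl he))
  have hwl : w ⊆ l := Subset.trans (subset_append_left _ _) hw.perm.subset
  have hwE : w ⊆ E := Subset.trans hwl hl
  refine ⟨w, mem_boundedLists.2 ⟨hw.length_le.trans (Nat.mul_le_mul ?_ hU), hwE⟩, hw.isWalk,
    hw.subset, hwl, cs, fun c hc => mem_closedWalksAt.2 ?_, hw.perm⟩
  · exact (Finset.card_le_card fun e he => mem_toFinset.2 (hwE (mem_toFinset.1 he))).trans
      (toFinset_card_le E)
  · obtain ⟨hlen, hcw, hcycle⟩ := hw.isCycle c hc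
    exact ⟨⟨hlen.trans hU, Subset.trans hcw hwE⟩, hcycle⟩

end Edge

variable [DecidableEq V] [DecidableEq α]

/-- A code for the profiles of the runs that go along the walk `w` from `p`, with detours along
short closed walks, and then go along the closed walk `r` forever. -/
def walkCode (E : List (Edge V α)) (p : V) (w r : List (Edge V α)) : ProfileCode α :=
  (Edge.word r, (Edge.word w).filter (· ∉ Edge.word r),
    (Edge.closedWalksAt E p w).map fun c => (Edge.word c).filter (· ∉ Edge.word r))

/-- Codes for the profiles accepted by the automaton with transitions `E`, initial states `I` and
accepting states `F`. -/
def profileCodes (E : List (Edge V α)) (I F : List V) : List (ProfileCode α) :=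
  let walks := boundedLists E (E.length * E.length)
  (((I ×ˢ F) ×ˢ walks ×ˢ walks).filter fun t => Edge.IsWalk t.1.1 t.2.1 t.1.2 ∧
    Edge.IsWalk t.1.2 t.2.2 t.1.2 ∧ t.2.2 ≠ []).map fun t => walkCode E t.1.1 t.2.1 t.2.2

theorem mem_profileCodes {γ : ProfileCode α} :
    γ ∈ profileCodes E I F ↔ ∃ p ∈ I, ∃ q ∈ F, ∃ w ∈ boundedLists E (E.length * E.length),
      ∃ r ∈ boundedLists E (E.length * E.length), Edge.IsWalk p w q ∧ Edge.IsWalk q r q ∧ r ≠ [] ∧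
        walkCode E p w r = γ := by
  simp only [profileCodes, mem_map, mem_filter, decide_eq_true_eq, Prod.exists, mem_product]
  grind

theorem profiles_profileCodes_subset :
    profiles (profileCodes E I F) ⊆ acceptedProfiles (edgeNFA E I F) := by
  rintro ⟨S, m⟩ ⟨γ, hγ, rfl, zs, hzs, hm⟩
  obtain ⟨p, hp, q, hq, w, hw, r, hr, hpwq, hqrq, hne, rfl⟩ := mem_profileCodes.1 hγ
  obtain ⟨cs, hcs, rfl⟩ := exists_subset_map_eq hzs
  simp only [subset_def, Edge.mem_closedWalksAt] at hcs
  obtain ⟨l, hperm, hl⟩ := hpwq.exists_perm_append_flatten fun c hc => (hcs hc).2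
  refine ⟨q, hq, Edge.word l, Edge.word r, mem_eval_iff.2 ⟨p, hp, mem_evalFrom_edgeNFA_iff.2
    ⟨l, Subset.trans hperm.subset (append_subset.2 ⟨(mem_boundedLists.1 hw).2, ?_⟩), hl, rfl⟩⟩,
    mem_evalFrom_edgeNFA_iff.2 ⟨r, (mem_boundedLists.1 hr).2, hqrq, rfl⟩,
    by simpa [Edge.word] using hne, rfl, ?_⟩
  · intro e he
    obtain ⟨c, hc, he⟩ := mem_flatten.1 he
    exact (hcs hc).1.2 he
  · simp only [walkCode, Edge.filter_word_append_flatten, mem_toFinset] at hm ⊢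
    rw [hm, Multiset.coe_eq_coe]
    exact (hperm.map _).filter _

theorem acceptedProfiles_edgeNFA_subset :
    acceptedProfiles (edgeNFA E I F) ⊆ profiles (profileCodes E I F) := by
  rintro ⟨S, m⟩ ⟨q, hq, x, y, hx, hy, hne, hS, hm⟩
  subst hS
  simp only [mem_toFinset] at hm
  obtain ⟨p, hp, hx⟩ := mem_eval_iff.1 hx
  obtain ⟨l, hlE, hl, rfl⟩ := mem_evalFrom_edgeNFA_iff.1 hx
  obtain ⟨l', hl'E, hl', rfl⟩ := mem_evalFrom_edgeNFA_iff.1 hy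
  obtain ⟨w, hw, hpwq, -, -, cs, hcs, hperm⟩ := hl.exists_isReduction_of_subset hlE
  obtain ⟨r, hr, hqrq, hl'r, hrl', -⟩ := hl'.exists_isReduction_of_subset hl'E
  have hletters : ∀ a, a ∈ Edge.word r ↔ a ∈ Edge.word l' := fun a =>
    ⟨fun h => map_subset _ hrl' h, fun h => map_subset _ hl'r h⟩
  refine ⟨_, mem_profileCodes.2 ⟨p, hp, q, hq, w, hw, r, hr, hpwq, hqrq, ?_, rfl⟩,
    Finset.ext fun a => by simp only [mem_toFinset, walkCode, hletters], _, map_subset _ hcs, ?_⟩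
  · rintro rfl
    rw [subset_nil] at hl'r
    exact hne (by rw [hl'r]; rfl)
  · simp only [walkCode, Edge.filter_word_append_flatten]
    rw [← hm, Multiset.coe_eq_coe]
    simp only [hletters]
    exact ((hperm.map _).filter _).symm

theorem profiles_profileCodes : profiles (profileCodes E I F) = acceptedProfiles (edgeNFA E I F) :=
  profiles_profileCodes_subset.antisymm acceptedProfiles_edgeNFA_subset

end EdgeAutomata

/-! ### An automaton for given profiles -/

section ProfileAutomaton

variable {α : Type*}

/-- The states of the automaton that realises profile codes: the letters that occur infinitely
often, the periods that may still be read, and the word that has to be read next. -/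
abbrev ProfileState (α : Type*) : Type _ := List α × List (List α) × List α

/-- An automaton that accepts the profiles described by `Γ`. For the code `(S, m, P)` it reads the
word `m` and then words of `P`, each announced by a letter of `S`. At some point it gives up `P`;
from then on it reads `S` over and over, announced by a letter of `S` again. The announcements take
the place of silent transitions; they do not affect the profile of a word that contains the letters
of `S` infinitely often. -/
def profileNFA (Γ : List (ProfileCode α)) : NFA α (ProfileState α) where
  step s a := {s' | s'.1 = s.1 ∧ (s'.2.1 = s.2.1 ∧ s.2.2 = a :: s'.2.2 ∨ s.2.2 = [] ∧ a ∈ s.1 ∧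
    (s'.2.1 = s.2.1 ∧ s'.2.2 ∈ s.2.1 ∧ s.1.Disjoint s'.2.2 ∨ s'.2 = ([], s.1)))}
  start := {s | ∃ γ ∈ Γ, γ.1.Disjoint γ.2.1 ∧ s = (γ.1, γ.2.2, γ.2.1)}
  accept := {s | s.2 = ([], [])}

variable {Γ : List (ProfileCode α)} {S t x : List α} {P zs : List (List α)} {s : ProfileState α}
  {a : α}

theorem mem_step_profileNFA_iff : s ∈ (profileNFA Γ).step (S, P, t) a ↔
    (∃ t', t = a :: t' ∧ s = (S, P, t')) ∨
      t = [] ∧ a ∈ S ∧ ((∃ z ∈ P, S.Disjoint z ∧ s = (S, P, z)) ∨ s = (S, [], S)) := by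
  obtain ⟨S', P', t'⟩ := s
  simp only [profileNFA, Set.mem_ofPred_eq, Prod.mk.injEq]
  grind

theorem mem_evalFrom_profileNFA_rest : (S, P, []) ∈ (profileNFA Γ).evalFrom {(S, P, t)} t := by
  induction t with
  | nil => exact Set.mem_singleton _
  | cons a t ih => exact mem_evalFrom_cons.2 ⟨(S, P, t), ⟨rfl, .inl ⟨rfl, rfl⟩⟩, ih⟩

theorem mem_evalFrom_profileNFA_periods (ha : a ∈ S) (hP : zs ⊆ P)
    (hdisj : ∀ z ∈ zs, S.Disjoint z) :
    (S, P, []) ∈ (profileNFA Γ).evalFrom {(S, P, [])} (zs.flatMap (cons a)) := by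
  induction zs with
  | nil => exact Set.mem_singleton _
  | cons z zs ih =>
    rw [cons_subset] at hP
    rw [forall_mem_cons] at hdisj
    rw [flatMap_cons, cons_append, mem_evalFrom_cons]
    refine ⟨(S, P, z), ⟨rfl, .inr ⟨rfl, ha, .inl ⟨rfl, hP.1, hdisj.1⟩⟩⟩, ?_⟩
    exact mem_evalFrom_append.2 ⟨_, mem_evalFrom_profileNFA_rest, ih hP.2 hdisj.2⟩

theorem mem_evalFrom_profileNFA_round (ha : a ∈ S) :
    (S, [], []) ∈ (profileNFA Γ).evalFrom {(S, P, [])} (a :: S) :=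
  mem_evalFrom_cons.2 ⟨(S, [], S), ⟨rfl, .inr ⟨rfl, ha, .inr rfl⟩⟩, mem_evalFrom_profileNFA_rest⟩

theorem subset_of_mem_evalFrom_profileNFA (hx : s ∈ (profileNFA Γ).evalFrom {(S, P, t)} x)
    (hs : s.2.2 = []) : t ⊆ x := by
  induction x generalizing P t with
  | nil =>
    rw [NFA.evalFrom_nil, Set.mem_singleton_iff] at hx
    subst hx
    exact hs ▸ nil_subset []
  | cons a x ih =>
    obtain ⟨s', hs', hx⟩ := mem_evalFrom_cons.1 hx
    rcases mem_step_profileNFA_iff.1 hs' with ⟨t', rfl, rfl⟩ | ⟨rfl, -⟩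
    · exact cons_subset_cons a (ih hx)
    · exact nil_subset _

variable [DecidableEq α]

theorem exists_periods_of_mem_evalFrom_profileNFA
    (hx : s ∈ (profileNFA Γ).evalFrom {(S, P, t)} x) :
    s.1 = S ∧ ∃ zs ⊆ P, (∀ z ∈ zs, S.Disjoint z) ∧
      (x ++ s.2.2).filter (· ∉ S) ~ (t ++ zs.flatten).filter (· ∉ S) := by
  induction x generalizing P t with
  | nil =>
    rw [NFA.evalFrom_nil, Set.mem_singleton_iff] at hx
    subst hx
    exact ⟨rfl, [], nil_subset P, by simp, by simp⟩
  | cons a x ih =>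
    obtain ⟨s', hs', hx⟩ := mem_evalFrom_cons.1 hx
    rcases mem_step_profileNFA_iff.1 hs' with
      ⟨t', rfl, rfl⟩ | ⟨rfl, ha, ⟨z, hz, hSz, rfl⟩ | rfl⟩ <;>
      obtain ⟨hs, zs, hzs, hdisj, hperm⟩ := ih hx <;> refine ⟨hs, ?_⟩
    · refine ⟨zs, hzs, hdisj, ?_⟩
      rw [cons_append, cons_append, filter_cons, filter_cons]
      split_ifs
      exacts [hperm.cons a, hperm]
    · refine ⟨z :: zs, cons_subset.2 ⟨hz, hzs⟩, forall_mem_cons.2 ⟨hSz, hdisj⟩, ?_⟩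
      rw [cons_append, filter_cons_of_neg (by simpa using ha)]
      exact hperm
    · obtain rfl := subset_nil.1 hzs
      refine ⟨[], nil_subset P, by simp, ?_⟩
      rw [cons_append, filter_cons_of_neg (by simpa using ha)]
      refine hperm.trans ?_
      simp

theorem filter_notMem_eq_self (h : S.Disjoint x) : x.filter (· ∉ S) = x :=
  filter_eq_self.2 fun _ ha => decide_eq_true fun haS => h haS ha

theorem filter_notMem_flatMap_cons (ha : a ∈ S) (hdisj : ∀ z ∈ zs, S.Disjoint z) :
    (zs.flatMap (cons a)).filter (· ∉ S) = zs.flatten := by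
  induction zs with
  | nil => rfl
  | cons z zs ih =>
    rw [forall_mem_cons] at hdisj
    rw [flatMap_cons, filter_append, ih hdisj.2, filter_cons_of_neg (by simpa using ha),
      filter_notMem_eq_self hdisj.1, flatten_cons]

theorem toFinset_eq_of_mem_evalFrom_profileNFA
    (hx : (S, [], []) ∈ (profileNFA Γ).evalFrom {(S, [], [])} x) (hne : x ≠ []) :
    x.toFinset = S.toFinset := by
  refine (toFinset.ext fun a => ⟨fun ha => ?_, fun ha => ?_⟩)
  · obtain ⟨-, zs, hzs, -, hperm⟩ := exists_periods_of_mem_evalFrom_profileNFA hx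
    obtain rfl := subset_nil.1 hzs
    rw [append_nil, flatten_nil, append_nil, filter_nil, perm_nil, filter_eq_nil_iff] at hperm
    simpa using hperm a ha
  · obtain ⟨b, x, rfl⟩ := exists_cons_of_ne_nil hne
    obtain ⟨s', hs', hx⟩ := mem_evalFrom_cons.1 hx
    rcases mem_step_profileNFA_iff.1 hs' with ⟨t', ht, -⟩ | ⟨-, -, ⟨z, hz, -⟩ | rfl⟩
    · exact absurd ht (cons_ne_nil b t').symm
    · exact absurd hz not_mem_nil
    · exact mem_cons_of_mem b (subset_of_mem_evalFrom_profileNFA hx rfl ha)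

theorem acceptedProfiles_profileNFA_subset : acceptedProfiles (profileNFA Γ) ⊆ profiles Γ := by
  rintro ⟨T, m⟩ ⟨⟨S, s⟩, hs, x, r, hx, hr, hne, hT, hm⟩
  obtain rfl : s = ([], []) := hs
  obtain ⟨_, ⟨γ, hγ, hbase, rfl⟩, hx⟩ := mem_eval_iff.1 hx
  obtain ⟨rfl, zs, hzs, hdisj, hperm⟩ := exists_periods_of_mem_evalFrom_profileNFA hx
  obtain rfl : γ.1.toFinset = T := (toFinset_eq_of_mem_evalFrom_profileNFA hr hne).symm.trans hT
  refine ⟨γ, hγ, rfl, zs, hzs, ?_⟩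
  have hflatten : γ.1.Disjoint (γ.2.1 ++ zs.flatten) := by
    refine disjoint_append_right.2 ⟨hbase, fun a haS ha => ?_⟩
    obtain ⟨z, hz, haz⟩ := mem_flatten.1 ha
    exact hdisj z hz haS haz
  rw [append_nil, filter_notMem_eq_self hflatten] at hperm
  simp only [mem_toFinset] at hm
  rw [← hm, Multiset.coe_eq_coe]
  exact hperm

theorem mem_acceptedProfiles_profileNFA_iff {p : Profile α} (hne : p.1.Nonempty)
    (hdisj : ∀ a ∈ p.2, a ∉ p.1) : p ∈ acceptedProfiles (profileNFA Γ) ↔ p ∈ profiles Γ := by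
  refine ⟨fun h => acceptedProfiles_profileNFA_subset h, ?_⟩
  obtain ⟨T, m⟩ := p
  rintro ⟨⟨S, t, P⟩, hγ, rfl, zs, hzs, rfl⟩
  obtain ⟨a, ha⟩ := hne
  simp only [mem_toFinset, Multiset.mem_coe] at ha hdisj
  have htS : S.Disjoint t := fun b hbS hbt => hdisj b (mem_append_left _ hbt) hbS
  have hzS : ∀ z ∈ zs, S.Disjoint z := fun z hz b hbS hbz =>
    hdisj b (mem_append_right _ (mem_flatten_of_mem hz hbz)) hbS
  refine ⟨(S, [], []), rfl, t ++ (zs.flatMap (cons a) ++ a :: S), a :: S,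
    mem_eval_iff.2 ⟨(S, P, t), ⟨_, hγ, htS, rfl⟩, ?_⟩, mem_evalFrom_profileNFA_round ha,
    cons_ne_nil a S, ?_, ?_⟩
  · exact mem_evalFrom_append.2 ⟨_, mem_evalFrom_profileNFA_rest, mem_evalFrom_append.2
      ⟨_, mem_evalFrom_profileNFA_periods ha hzs hzS, mem_evalFrom_profileNFA_round ha⟩⟩
  · rw [toFinset_cons, Finset.insert_eq_of_mem (mem_toFinset.2 ha)]
  · simp only [mem_toFinset, filter_append, filter_notMem_eq_self htS,
      filter_notMem_flatMap_cons ha hzS]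
    rw [show (a :: S).filter (· ∉ S) = [] by simp [ha], append_nil]

end ProfileAutomaton

/-! ### Automaton codes -/

section Pullback

variable {α β Q Q' : Type*} {A : NFA α Q} {M : NFA β Q'} {g : α → β} {f : Q → Q'}

theorem parikh_comp (hg : Function.Injective g) (w : ℕ → α) (a : α) :
    parikh (g ∘ w) (g a) = parikh w a := by
  simp only [parikh, Function.comp_apply, hg.eq_iff]

/-- The automaton `A` arises from `M` by renaming the letters along `g` and the states along `f`,
and the states outside the range of `f` cannot be reached in `M`. -/
structure IsPullback (A : NFA α Q) (M : NFA β Q') (g : α → β) (f : Q → Q') : Prop where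
  mem_step : ∀ q a q', q' ∈ A.step q a ↔ f q' ∈ M.step (f q) (g a)
  mem_start : ∀ q, q ∈ A.start ↔ f q ∈ M.start
  mem_accept : ∀ q, q ∈ A.accept ↔ f q ∈ M.accept
  start_subset : M.start ⊆ Set.range f
  step_subset : ∀ q b, M.step (f q) b ⊆ Set.range f

namespace IsPullback

theorem mem_buchiLanguage_iff (h : IsPullback A M g f) {w : ℕ → α} :
    w ∈ buchiLanguage A ↔ g ∘ w ∈ buchiLanguage M := by
  constructor
  · rintro ⟨ρ, ⟨hstart, hρ⟩, q, hq, haccept⟩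
    refine ⟨f ∘ ρ, ⟨(h.mem_start _).1 hstart, fun i => (h.mem_step _ _ _).1 (hρ i)⟩, f q,
      fun i => ?_, (h.mem_accept q).1 haccept⟩
    obtain ⟨j, hij, rfl⟩ := hq i
    exact ⟨j, hij, rfl⟩
  · rintro ⟨ρ, ⟨hstart, hρ⟩, q, hq, haccept⟩
    have hrange : ∀ i, ρ i ∈ Set.range f := fun i => by
      induction i with
      | zero => exact h.start_subset hstart
      | succ i ih =>
        obtain ⟨q', hq'⟩ := ih
        exact h.step_subset q' _ (hq' ▸ hρ i)
    have : Nonempty Q := ⟨(hrange 0).choose⟩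
    have hinv : ∀ i, f (Function.invFun f (ρ i)) = ρ i := fun i => Function.invFun_eq (hrange i)
    refine ⟨fun i => Function.invFun f (ρ i), ⟨(h.mem_start _).2 ?_, fun i =>
      (h.mem_step _ _ _).2 ?_⟩, Function.invFun f q, fun i => ?_, (h.mem_accept _).2 ?_⟩
    · rwa [hinv]
    · rw [hinv, hinv]
      exact hρ i
    · obtain ⟨j, hij, rfl⟩ := hq i
      exact ⟨j, hij, rfl⟩
    · obtain ⟨j, -, rfl⟩ := hq 0
      rwa [hinv]

theorem mem_jumpingLanguage_iff (h : IsPullback A M g f) (hg : Function.Injective g) {w : ℕ → α} :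
    w ∈ jumpingLanguage A ↔ g ∘ w ∈ jumpingLanguage M := by
  constructor
  · rintro ⟨w', hw', haccept⟩
    refine ⟨g ∘ w', funext fun b => ?_, h.mem_buchiLanguage_iff.1 haccept⟩
    by_cases hb : b ∈ Set.range g
    · obtain ⟨a, rfl⟩ := hb
      rw [parikh_comp hg, parikh_comp hg, hw']
    · have hzero : ∀ v : ℕ → α, parikh (g ∘ v) b = 0 := fun v =>
        parikh_eq_zero_iff.2 fun i hi => hb ⟨v i, hi⟩
      rw [hzero, hzero]
  · rintro ⟨v, hv, haccept⟩
    have hrange : ∀ i, ∃ a, g a = v i := fun i => by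
      by_contra hvi
      have hzero : parikh (g ∘ w) (v i) = 0 := parikh_eq_zero_iff.2 fun j hj => hvi ⟨_, hj⟩
      exact parikh_eq_zero_iff.1 (hv ▸ hzero) i rfl
    choose w' hw' using hrange
    obtain rfl : g ∘ w' = v := funext hw'
    exact ⟨w', funext fun a => by rw [← parikh_comp hg, hv, parikh_comp hg],
      h.mem_buchiLanguage_iff.2 haccept⟩

end IsPullback

end Pullback

section Codes

/-- The transitions of `c` that are meaningful over the letters less than `k`. -/
def AutomatonCode.edges (c : AutomatonCode) (k : ℕ) : List (Edge ℕ ℕ) :=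
  c.transitions.filter fun e => e.1 < c.numStates ∧ e.2.1 < k ∧ e.2.2 < c.numStates

/-- The initial states of `c` that are meaningful. -/
def AutomatonCode.starts (c : AutomatonCode) : List ℕ := c.initial.filter (· < c.numStates)

/-- The automaton described by a code over the letters less than `k`, with letters and states
given by their numbers. -/
def natNFA (k : ℕ) (c : AutomatonCode) : NFA ℕ ℕ := edgeNFA (c.edges k) c.starts c.accepting

theorem AutomatonCode.Describes.isPullback {α Q : Type*} {k : ℕ} {c : AutomatonCode} {e : α ≃ Fin k}
    {A : NFA α Q} (h : c.Describes e A) :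
    ∃ f : Q → ℕ, IsPullback A (natNFA k c) (fun a => e a) f := by
  obtain ⟨g, hstep, hstart, haccept⟩ := h
  have hrange : ∀ i < c.numStates, i ∈ Set.range fun q => (g q : ℕ) := fun i hi =>
    ⟨g.symm ⟨i, hi⟩, by simp⟩
  refine ⟨fun q => g q, fun q a q' => ?_, fun q => ?_, haccept, fun i hi => ?_, fun q a i hi => ?_⟩
  · simp [natNFA, edgeNFA, AutomatonCode.edges, hstep]
  · simp [natNFA, edgeNFA, AutomatonCode.starts, hstart]
  · exact hrange i (of_decide_eq_true (mem_filter.1 hi).2)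
  · exact hrange i (of_decide_eq_true (mem_filter.1 hi).2).2.2

open Classical in
/-- A code for the part of `M` that consists of the states in `L` and the letters less than `k`;
the states are numbered by their positions in `L`. -/
noncomputable def codeOf {Q : Type*} [Inhabited Q] (k : ℕ) (L : List Q) (M : NFA ℕ Q) :
    AutomatonCode :=
  (L.length,
    (range L.length ×ˢ range k ×ˢ range L.length).filter fun t =>
      L.getD t.2.2 default ∈ M.step (L.getD t.1 default) t.2.1,
    (range L.length).filter fun i => L.getD i default ∈ M.start,
    (range L.length).filter fun i => L.getD i default ∈ M.accept)

open Classical in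
theorem isPullback_codeOf {α Q : Type*} [Inhabited Q] {k : ℕ} {L : List Q} {M : NFA ℕ Q}
    (e : α ≃ Fin k) (hstart : ∀ q ∈ M.start, q ∈ L)
    (hstep : ∀ q ∈ L, ∀ a, ∀ q' ∈ M.step q a, q' ∈ L) :
    IsPullback ((codeOf k L M).toNFA e) M (fun a => e a) L.get where
  mem_step q a q' := by
    refine mem_filter.trans ((and_iff_right ?_).trans ?_)
    · exact pair_mem_product.2 ⟨mem_range.2 q.2,
        pair_mem_product.2 ⟨mem_range.2 (e a).2, mem_range.2 q'.2⟩⟩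
    · rw [decide_eq_true_iff, getD_eq_getElem _ _ q.2, getD_eq_getElem _ _ q'.2]
      rfl
  mem_start q := by
    refine mem_filter.trans ((and_iff_right (mem_range.2 q.2)).trans ?_)
    rw [decide_eq_true_iff, getD_eq_getElem _ _ q.2]
    rfl
  mem_accept q := by
    refine mem_filter.trans ((and_iff_right (mem_range.2 q.2)).trans ?_)
    rw [decide_eq_true_iff, getD_eq_getElem _ _ q.2]
    rfl
  start_subset q hq := mem_iff_get.1 (hstart q hq)
  step_subset q a q' hq' := mem_iff_get.1 (hstep _ (get_mem L q) a q' hq')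

/-- A list that contains all reachable states of `profileNFA Γ`. -/
def profileStates {α : Type*} (Γ : List (ProfileCode α)) : List (ProfileState α) :=
  Γ.flatMap fun γ => [γ.1] ×ˢ [γ.2.2, []] ×ˢ
    boundedLists (γ.1 ++ γ.2.letters) (γ.1 ++ γ.2.letters).length

section

variable {α : Type*} {Γ : List (ProfileCode α)}

theorem mem_profileStates {s : ProfileState α} :
    s ∈ profileStates Γ ↔ ∃ γ ∈ Γ, s.1 = γ.1 ∧ (s.2.1 = γ.2.2 ∨ s.2.1 = []) ∧
      s.2.2.length ≤ (γ.1 ++ γ.2.letters).length ∧ s.2.2 ⊆ γ.1 ++ γ.2.letters := by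
  obtain ⟨S, P, t⟩ := s
  refine mem_flatMap.trans (exists_congr fun γ => and_congr_right' ?_)
  refine pair_mem_product.trans (and_congr mem_singleton (pair_mem_product.trans ?_))
  rw [mem_pair, mem_boundedLists]

theorem start_profileNFA_subset : ∀ s ∈ (profileNFA Γ).start, s ∈ profileStates Γ := by
  rintro _ ⟨γ, hγ, -, rfl⟩
  have hbase : γ.2.1 <+ γ.1 ++ γ.2.letters :=
    (sublist_flatten_of_mem mem_cons_self).trans (sublist_append_right _ _)
  exact mem_profileStates.2 ⟨γ, hγ, rfl, .inl rfl, hbase.length_le, hbase.subset⟩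

theorem step_profileNFA_subset : ∀ s ∈ profileStates Γ, ∀ a, ∀ s' ∈ (profileNFA Γ).step s a,
    s' ∈ profileStates Γ := by
  rintro ⟨S, P, t⟩ hs a s' hs'
  obtain ⟨γ, hγ, rfl, hP, ht⟩ := mem_profileStates.1 hs
  rw [mem_profileStates]
  rcases mem_step_profileNFA_iff.1 hs' with ⟨t', rfl, rfl⟩ | ⟨rfl, -, ⟨z, hz, -, rfl⟩ | rfl⟩
  · exact ⟨γ, hγ, rfl, hP, (Nat.le_succ _).trans ht.1, (cons_subset.1 ht.2).2⟩
  · have hzP : z ∈ γ.2.2 := by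
      rcases hP with rfl | rfl
      exacts [hz, absurd hz not_mem_nil]
    have hperiod : z <+ γ.1 ++ γ.2.letters :=
      (sublist_flatten_of_mem (mem_cons_of_mem _ hzP)).trans (sublist_append_right _ _)
    exact ⟨γ, hγ, rfl, hP, hperiod.length_le, hperiod.subset⟩
  · exact ⟨γ, hγ, rfl, .inr rfl, (sublist_append_left _ _).length_le,
      (sublist_append_left _ _).subset⟩

end

/-- Codes for the profiles of the words accepted by the automaton that `c` describes. -/
def acceptedCodes (k : ℕ) (c : AutomatonCode) : List (ProfileCode ℕ) :=
  profileCodes (c.edges k) c.starts c.accepting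

theorem profiles_acceptedCodes (k : ℕ) (c : AutomatonCode) :
    profiles (acceptedCodes k c) = acceptedProfiles (natNFA k c) :=
  profiles_profileCodes

/-- A code for an automaton whose jumping language is the intersection of the jumping languages of
the automata described by `c` and `d`. -/
noncomputable def interCode (k : ℕ) (c d : AutomatonCode) : AutomatonCode :=
  codeOf k (profileStates (interCodes (acceptedCodes k c) (acceptedCodes k d)))
    (profileNFA (interCodes (acceptedCodes k c) (acceptedCodes k d)))

variable {α : Type*} {k : ℕ} {e : α ≃ Fin k} {w : ℕ → α} {p : Profile ℕ}

theorem AutomatonCode.Describes.mem_jumpingLanguage_iff {Q : Type*} {A : NFA α Q}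
    {c : AutomatonCode} (h : c.Describes e A) (hp : IsProfile (fun i => (e (w i) : ℕ)) p) :
    w ∈ jumpingLanguage A ↔ p ∈ profiles (acceptedCodes k c) := by
  obtain ⟨f, hf⟩ := h.isPullback
  rw [hf.mem_jumpingLanguage_iff (Fin.val_injective.comp e.injective), profiles_acceptedCodes]
  exact JumpingAutomata.mem_jumpingLanguage_iff hp

theorem mem_jumpingLanguage_codeOf_profileNFA_iff {Γ : List (ProfileCode ℕ)}
    (hp : IsProfile (fun i => (e (w i) : ℕ)) p) :
    w ∈ jumpingLanguage ((codeOf k (profileStates Γ) (profileNFA Γ)).toNFA e) ↔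
      p ∈ profiles Γ := by
  obtain ⟨N, hN⟩ := hp.eventually_mem
  rw [(isPullback_codeOf e start_profileNFA_subset
    step_profileNFA_subset).mem_jumpingLanguage_iff (Fin.val_injective.comp e.injective),
    ← mem_acceptedProfiles_profileNFA_iff ⟨_, hN N le_rfl⟩ hp.2]
  exact mem_jumpingLanguage_iff hp

theorem jumpingLanguage_interCode {Q₁ Q₂ : Type*} {A : NFA α Q₁} {B : NFA α Q₂}
    {c d : AutomatonCode} (hc : c.Describes e A) (hd : d.Describes e B) :
    jumpingLanguage ((interCode k c d).toNFA e) = jumpingLanguage A ∩ jumpingLanguage B := by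
  ext w
  have hfin : (Set.range fun i => (e (w i) : ℕ)).Finite :=
    (Set.finite_lt_nat k).subset (Set.range_subset_iff.2 fun i => (e (w i)).2)
  obtain ⟨p, hp⟩ := exists_isProfile hfin
  rw [Set.mem_inter_iff, hc.mem_jumpingLanguage_iff hp, hd.mem_jumpingLanguage_iff hp, interCode,
    mem_jumpingLanguage_codeOf_profileNFA_iff hp, profiles_interCodes, Set.mem_inter_iff]

end Codes

/-! ### Primitive recursiveness -/

namespace Edge

theorem isWalk_iff_foldl {V α : Type*} [DecidableEq V] {p q : V} {l : List (Edge V α)} :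
    IsWalk p l q ↔ l.foldl (fun o e => if o = some e.1 then some e.2.2 else none) (some p) =
      some q := by
  have foldl_none : ∀ l : List (Edge V α), l.foldl
      (fun o e => if o = some e.1 then some e.2.2 else none) none = none := fun l => by
    induction l with
    | nil => rfl
    | cons e l ih => simpa using ih
  induction l generalizing p with
  | nil => simp [IsWalk]
  | cons e l ih =>
    rw [IsWalk, foldl_cons]
    by_cases h : e.1 = p
    · simp [h, ih]
    · simp [h, Ne.symm h, foldl_none]

end Edge

section Primrec

open Primrec (fst snd pair const)

variable {ι α β V : Type*} [Primcodable ι] [Primcodable α] [Primcodable β] [Primcodable V]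

theorem primrecPred_exists_mem {l : ι → List β} {p : ι → β → Prop} (hl : Primrec l)
    (hp : PrimrecPred fun y : ι × β => p y.1 y.2) : PrimrecPred fun i => ∃ b ∈ l i, p i b :=
  PrimrecRel.exists_mem_list (R := fun b i => p i b) (hp.comp (pair snd fst)) |>.comp hl .id

theorem primrecPred_forall_mem {l : ι → List β} {p : ι → β → Prop} (hl : Primrec l)
    (hp : PrimrecPred fun y : ι × β => p y.1 y.2) : PrimrecPred fun i => ∀ b ∈ l i, p i b :=
  PrimrecRel.forall_mem_list (R := fun b i => p i b) (hp.comp (pair snd fst)) |>.comp hl .id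

theorem primrec_filter {l : ι → List β} {p : ι → β → Prop} [∀ i, DecidablePred (p i)]
    (hl : Primrec l) (hp : PrimrecPred fun y : ι × β => p y.1 y.2) :
    Primrec fun i => (l i).filter fun b => p i b :=
  let _ : DecidableRel fun b i => p i b := fun b i => inferInstanceAs (Decidable (p i b))
  PrimrecRel.listFilter (R := fun b i => p i b) (hp.comp (pair snd fst)) |>.comp hl .id

theorem primrecPred_mem {l : ι → List β} {f : ι → β} (hl : Primrec l) (hf : Primrec f) :
    PrimrecPred fun i => f i ∈ l i :=
  (primrecPred_exists_mem hl (Primrec.eq.comp snd (hf.comp fst))).of_eq fun _ => exists_eq_right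

theorem primrecPred_disjoint {l m : ι → List β} (hl : Primrec l) (hm : Primrec m) :
    PrimrecPred fun i => (l i).Disjoint (m i) :=
  primrecPred_forall_mem hl (primrecPred_mem (hm.comp fst) snd).not

theorem primrecPred_toFinset_eq [DecidableEq β] {l m : ι → List β} (hl : Primrec l)
    (hm : Primrec m) : PrimrecPred fun i => (l i).toFinset = (m i).toFinset :=
  have hsub : ∀ {l m : ι → List β}, Primrec l → Primrec m → PrimrecPred fun i => l i ⊆ m i :=
    fun hl hm => primrecPred_forall_mem hl (primrecPred_mem (hm.comp fst) snd)
  ((hsub hl hm).and (hsub hm hl)).of_eq fun i => by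
    simp only [Finset.Subset.antisymm_iff, Finset.subset_iff, mem_toFinset, List.subset_def]

theorem primrecPred_perm {l m : ι → List β} (hl : Primrec l) (hm : Primrec m) :
    PrimrecPred fun i => l i ~ m i := by
  classical
  have hcount : ∀ {l : ι → List β}, Primrec l → Primrec₂ fun i b => (l i).count b := fun hl =>
    (Primrec.list_length.comp (primrec_filter (hl.comp fst)
      (Primrec.eq.comp snd (snd.comp fst)))).of_eq fun _ => countP_eq_length_filter.symm
  have hforall : PrimrecPred fun i => ∀ b ∈ l i ++ m i, (l i).count b = (m i).count b :=
    primrecPred_forall_mem (Primrec.list_append.comp hl hm)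
      (Primrec.eq.comp (hcount hl) (hcount hm))
  refine hforall.of_eq fun i => ?_
  refine ⟨fun h => perm_iff_count.2 fun b => ?_, fun h b _ => h.count_eq b⟩
  by_cases hb : b ∈ l i ++ m i
  · exact h b hb
  · rw [mem_append, not_or] at hb
    rw [count_eq_zero_of_not_mem hb.1, count_eq_zero_of_not_mem hb.2]

theorem primrec_product {l : ι → List α} {m : ι → List β} (hl : Primrec l) (hm : Primrec m) :
    Primrec fun i => l i ×ˢ m i :=
  Primrec.list_flatMap hl (Primrec.list_map (hm.comp fst) (pair (snd.comp fst) snd))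

theorem primrec_boundedLists {l : ι → List β} {n : ι → ℕ} (hl : Primrec l) (hn : Primrec n) :
    Primrec fun i => boundedLists (l i) (n i) := by
  have hsucc : Primrec₂ fun i (y : ℕ × List (List β)) =>
      [] :: (l i).flatMap fun b => y.2.map (cons b) :=
    Primrec.list_cons.comp (const []) (Primrec.list_flatMap (hl.comp fst)
      (Primrec.list_map (snd.comp (snd.comp fst)) (Primrec.list_cons.comp (snd.comp fst) snd)))
  refine (Primrec.nat_rec' hn (const [[]]) hsucc).of_eq fun i => ?_
  induction n i with
  | zero => rfl
  | succ n ih => rw [boundedLists, ← ih]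

theorem primrec_zeroSumBound {K d : ι → ℕ} (hK : Primrec K) (hd : Primrec d) :
    Primrec fun i => zeroSumBound (K i) (d i) := by
  have hrec : Primrec fun y : ι × ℕ × ℕ => y.2.2 := snd.comp snd
  have hsucc : Primrec₂ fun i (y : ℕ × ℕ) => y.2 * (2 * (y.2 * K i) + 1) :=
    Primrec.nat_mul.comp hrec (Primrec.succ.comp
      (Primrec.nat_mul.comp (const 2) (Primrec.nat_mul.comp hrec (hK.comp fst))))
  refine (Primrec.nat_rec' hd (const 1) hsucc).of_eq fun i => ?_
  induction d i with
  | zero => rfl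
  | succ d ih => rw [zeroSumBound, ← ih]

namespace LinearCode

variable {X Y : ι → LinearCode α}

theorem primrec_letters (hX : Primrec X) : Primrec fun i => (X i).letters :=
  Primrec.list_flatten.comp (Primrec.list_cons.comp (fst.comp hX) (snd.comp hX))

theorem primrec_balanceBound (hX : Primrec X) (hY : Primrec Y) :
    Primrec fun i => (X i).balanceBound (Y i) :=
  have hlength := Primrec.list_length.comp
    (Primrec.list_append.comp (primrec_letters hX) (primrec_letters hY))
  primrec_zeroSumBound hlength hlength

theorem primrec_periodPairs (hX : Primrec X) (hY : Primrec Y) :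
    Primrec fun i => (X i).periodPairs (Y i) :=
  primrec_product (Primrec.list_cons.comp (const []) (snd.comp hX))
    (Primrec.list_cons.comp (const []) (snd.comp hY))

theorem primrecPred_balanced {qs : ι → List (List α × List α)} (hqs : Primrec qs) :
    PrimrecPred fun i => Balanced (qs i) :=
  primrecPred_perm (Primrec.list_flatMap hqs (fst.comp snd))
    (Primrec.list_flatMap hqs (snd.comp snd))

theorem primrec_inter [DecidableEq α] (hX : Primrec X) (hY : Primrec Y) :
    Primrec fun i => (X i).inter (Y i) := by
  have hblocks := primrec_boundedLists (primrec_periodPairs hX hY) (primrec_balanceBound hX hY)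
  refine Primrec.list_map (primrec_filter hblocks (primrecPred_balanced (Primrec.list_cons.comp
    ((pair (fst.comp hX) (fst.comp hY)).comp fst) snd))) (pair ?_ ?_)
  · exact Primrec.list_append.comp (fst.comp (hX.comp fst))
      (Primrec.list_flatMap snd (fst.comp snd))
  · exact Primrec.list_map (primrec_filter (hblocks.comp fst) (primrecPred_balanced snd))
      (Primrec.list_flatMap snd (fst.comp snd))

end LinearCode

theorem primrec_interCodes [DecidableEq α] {Γ Δ : ι → List (ProfileCode α)} (hΓ : Primrec Γ)
    (hΔ : Primrec Δ) : Primrec fun i => interCodes (Γ i) (Δ i) :=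
  Primrec.list_flatMap
    (primrec_filter (primrec_product hΓ hΔ)
      (primrecPred_toFinset_eq (fst.comp (fst.comp snd)) (fst.comp (snd.comp snd))))
    (Primrec.list_map (LinearCode.primrec_inter (snd.comp (fst.comp snd)) (snd.comp (snd.comp snd)))
      (pair (fst.comp (fst.comp (snd.comp fst))) snd))

namespace Edge

variable {p q : ι → V} {E l w r : ι → List (Edge V α)}

theorem primrec_word (hl : Primrec l) : Primrec fun i => word (l i) :=
  Primrec.list_map hl (fst.comp (snd.comp snd))

theorem primrec_support (hp : Primrec p) (hl : Primrec l) :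
    Primrec fun i => support (p i) (l i) :=
  Primrec.list_cons.comp hp (Primrec.list_map hl (snd.comp (snd.comp snd)))

theorem primrecPred_isWalk (hp : Primrec p) (hl : Primrec l) (hq : Primrec q) :
    PrimrecPred fun i => IsWalk (p i) (l i) (q i) := by
  classical
  have hstep : Primrec₂ fun (_ : ι) (y : Option V × Edge V α) =>
      if y.1 = some y.2.1 then some y.2.2.2 else none :=
    Primrec.ite
      (Primrec.eq.comp (fst.comp snd) (Primrec.option_some.comp (fst.comp (snd.comp snd))))
      (Primrec.option_some.comp (snd.comp (snd.comp (snd.comp snd)))) (const none)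
  exact (Primrec.eq.comp (Primrec.list_foldl hl (Primrec.option_some.comp hp) hstep)
    (Primrec.option_some.comp hq)).of_eq fun i => isWalk_iff_foldl.symm

theorem primrec_closedWalksAt [DecidableEq V] (hE : Primrec E) (hp : Primrec p) (hw : Primrec w) :
    Primrec fun i => closedWalksAt (E i) (p i) (w i) :=
  primrec_filter (primrec_boundedLists hE (Primrec.list_length.comp hE))
    (primrecPred_exists_mem (primrec_support (hp.comp fst) (hw.comp fst))
      (primrecPred_isWalk snd (snd.comp fst) snd))

end Edge

section

variable [DecidableEq V] [DecidableEq α]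

theorem primrec_walkCode {E w r : ι → List (Edge V α)} {p : ι → V} (hE : Primrec E)
    (hp : Primrec p) (hw : Primrec w) (hr : Primrec r) :
    Primrec fun i => walkCode (E i) (p i) (w i) (r i) := by
  have hfilter : Primrec₂ fun i (l : List (Edge V α)) =>
      (Edge.word l).filter (· ∉ Edge.word (r i)) :=
    primrec_filter (Edge.primrec_word snd)
      (primrecPred_mem (Edge.primrec_word ((hr.comp fst).comp fst)) snd).not
  exact pair (Edge.primrec_word hr) (pair (hfilter.comp .id hw)
    (Primrec.list_map (Edge.primrec_closedWalksAt hE hp hw) hfilter))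

theorem primrec_profileCodes {E : ι → List (Edge V α)} {I F : ι → List V} (hE : Primrec E)
    (hI : Primrec I) (hF : Primrec F) : Primrec fun i => profileCodes (E i) (I i) (F i) := by
  have hlength := Primrec.list_length.comp hE
  have hwalks := primrec_boundedLists hE (Primrec.nat_mul.comp hlength hlength)
  have hstart : Primrec fun y : ι × (V × V) × List (Edge V α) × List (Edge V α) => y.2.1.1 :=
    fst.comp (fst.comp snd)
  have hend : Primrec fun y : ι × (V × V) × List (Edge V α) × List (Edge V α) => y.2.1.2 :=
    snd.comp (fst.comp snd)
  have hpath : Primrec fun y : ι × (V × V) × List (Edge V α) × List (Edge V α) => y.2.2.1 :=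
    fst.comp (snd.comp snd)
  have hcycle : Primrec fun y : ι × (V × V) × List (Edge V α) × List (Edge V α) => y.2.2.2 :=
    snd.comp (snd.comp snd)
  refine Primrec.list_map (primrec_filter
    (primrec_product (primrec_product hI hF) (primrec_product hwalks hwalks)) ?_) ?_
  · exact (Edge.primrecPred_isWalk hstart hpath hend).and
      ((Edge.primrecPred_isWalk hend hcycle hend).and (Primrec.eq.comp hcycle (const [])).not)
  · exact primrec_walkCode (hE.comp fst) hstart hpath hcycle

end

section ProfileAutomaton

variable {Γ : ι → List (ProfileCode α)} {s s' : ι → ProfileState α} {a : ι → α}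

theorem primrecPred_mem_step_profileNFA (hs : Primrec s) (ha : Primrec a) (hs' : Primrec s') :
    PrimrecPred fun i => s' i ∈ (profileNFA (Γ i)).step (s i) (a i) := by
  have hperiods : PrimrecPred fun i => (s' i).2.1 = (s i).2.1 :=
    Primrec.eq.comp (fst.comp (snd.comp hs')) (fst.comp (snd.comp hs))
  have hword := snd.comp (snd.comp hs')
  refine .and (Primrec.eq.comp (fst.comp hs') (fst.comp hs)) (.or (hperiods.and ?_) (.and ?_ ?_))
  · exact Primrec.eq.comp (snd.comp (snd.comp hs)) (Primrec.list_cons.comp ha hword)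
  · exact Primrec.eq.comp (snd.comp (snd.comp hs)) (const [])
  · refine (primrecPred_mem (fst.comp hs) ha).and (.or (hperiods.and (.and ?_ ?_)) ?_)
    · exact primrecPred_mem (fst.comp (snd.comp hs)) hword
    · exact primrecPred_disjoint (fst.comp hs) hword
    · exact Primrec.eq.comp (snd.comp hs') (pair (const []) (fst.comp hs))

theorem primrecPred_mem_start_profileNFA (hΓ : Primrec Γ) (hs : Primrec s) :
    PrimrecPred fun i => s i ∈ (profileNFA (Γ i)).start :=
  have hbase := fst.comp (snd.comp snd)
  primrecPred_exists_mem hΓ ((primrecPred_disjoint (fst.comp snd) hbase).and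
    (Primrec.eq.comp (hs.comp fst) (pair (fst.comp snd) (pair (snd.comp (snd.comp snd)) hbase))))

theorem primrecPred_mem_accept_profileNFA (hs : Primrec s) :
    PrimrecPred fun i => s i ∈ (profileNFA (Γ i)).accept :=
  Primrec.eq.comp (snd.comp hs) (const ([], []))

theorem primrec_profileStates (hΓ : Primrec Γ) : Primrec fun i => profileStates (Γ i) := by
  have hletters : Primrec fun y : ι × ProfileCode α => y.2.1 ++ y.2.2.letters :=
    Primrec.list_append.comp (fst.comp snd) (LinearCode.primrec_letters (snd.comp snd))
  have hperiods : Primrec fun y : ι × ProfileCode α => y.2.2.2 := snd.comp (snd.comp snd)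
  exact Primrec.list_flatMap hΓ (primrec_product
    (Primrec.list_cons.comp (fst.comp snd) (const [])) (primrec_product
      (Primrec.list_cons.comp hperiods (const [[]]))
      (primrec_boundedLists hletters (Primrec.list_length.comp hletters))))

end ProfileAutomaton

theorem primrec_codeOf {Q : Type*} [Primcodable Q] [Inhabited Q] {k : ι → ℕ} {L : ι → List Q}
    {M : ι → NFA ℕ Q} (hk : Primrec k) (hL : Primrec L)
    (hstep : PrimrecPred fun y : ι × Q × ℕ × Q => y.2.2.2 ∈ (M y.1).step y.2.1 y.2.2.1)
    (hstart : PrimrecPred fun y : ι × Q => y.2 ∈ (M y.1).start)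
    (haccept : PrimrecPred fun y : ι × Q => y.2 ∈ (M y.1).accept) :
    Primrec fun i => codeOf (k i) (L i) (M i) := by
  classical
  have hlength := Primrec.list_length.comp hL
  have hrange := Primrec.list_range.comp hlength
  have hget : ∀ {κ : Type _} [Primcodable κ] {n : κ → ℕ}, Primrec n →
      Primrec fun y : ι × κ => (L y.1).getD (n y.2) default := fun hn =>
    (Primrec.list_getD default).comp (hL.comp fst) (hn.comp snd)
  refine pair hlength (pair (primrec_filter
    (primrec_product hrange (primrec_product (Primrec.list_range.comp hk) hrange)) ?_)
    (pair (primrec_filter hrange ?_) (primrec_filter hrange ?_)))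
  · exact hstep.comp (pair fst (pair (hget fst)
      (pair (fst.comp (snd.comp snd)) (hget (snd.comp snd)))))
  · exact hstart.comp (pair fst (hget .id))
  · exact haccept.comp (pair fst (hget .id))

section Codes

variable {k : ι → ℕ} {c d : ι → AutomatonCode}

theorem primrec_acceptedCodes (hk : Primrec k) (hc : Primrec c) :
    Primrec fun i => acceptedCodes (k i) (c i) := by
  have hnumStates : ∀ {κ : Type} [Primcodable κ], Primrec fun y : ι × κ => (c y.1).numStates :=
    fst.comp (hc.comp fst)
  refine primrec_profileCodes (primrec_filter (fst.comp (snd.comp hc)) ?_)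
    (primrec_filter (fst.comp (snd.comp (snd.comp hc))) (Primrec.nat_lt.comp snd hnumStates))
    (snd.comp (snd.comp (snd.comp hc)))
  exact (Primrec.nat_lt.comp (fst.comp snd) hnumStates).and
    ((Primrec.nat_lt.comp (fst.comp (snd.comp snd)) (hk.comp fst)).and
      (Primrec.nat_lt.comp (snd.comp (snd.comp snd)) hnumStates))

theorem primrec_interCode (hk : Primrec k) (hc : Primrec c) (hd : Primrec d) :
    Primrec fun i => interCode (k i) (c i) (d i) := by
  have hΓ := primrec_interCodes (primrec_acceptedCodes hk hc) (primrec_acceptedCodes hk hd)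
  exact primrec_codeOf hk (primrec_profileStates hΓ)
    (primrecPred_mem_step_profileNFA (fst.comp snd) (fst.comp (snd.comp snd))
      (snd.comp (snd.comp snd)))
    (primrecPred_mem_start_profileNFA (hΓ.comp fst) snd) (primrecPred_mem_accept_profileNFA snd)

end Codes

end Primrec

end JumpingAutomata

/-- There is one algorithm `f` that turns the size `k` of the alphabet and descriptions `c`, `d` of
automata `A`, `B` over a common alphabet into a description of an automaton whose jumping language
is the intersection of the jumping languages of `A` and `B`. -/
theorem mainTheorem2 :
    ∃ f : ℕ × JumpingAutomata.AutomatonCode × JumpingAutomata.AutomatonCode →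
        JumpingAutomata.AutomatonCode,
      Computable f ∧
      ∀ (k : ℕ) (α : Type*) (e : α ≃ Fin k) (Q₁ : Type*) (Q₂ : Type*) [Finite Q₁] [Finite Q₂]
        (A : NFA α Q₁) (B : NFA α Q₂) (c d : JumpingAutomata.AutomatonCode),
        c.Describes e A → d.Describes e B →
          JumpingAutomata.jumpingLanguage ((f (k, c, d)).toNFA e) =
            JumpingAutomata.jumpingLanguage A ∩ JumpingAutomata.jumpingLanguage B :=
  ⟨fun y => JumpingAutomata.interCode y.1 y.2.1 y.2.2,
    (JumpingAutomata.primrec_interCode Primrec.fst (Primrec.fst.comp Primrec.snd)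
      (Primrec.snd.comp Primrec.snd)).to_comp,
    fun _ _ _ _ _ _ _ _ _ _ _ hc hd => JumpingAutomata.jumpingLanguage_interCode hc hd⟩
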